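/- **Circuits and metrics.** Let $\mathcal M$ be a strict symmetric premonoidal category (associators and unitors are identities, symmetries are central, no interchange law is assumed); $C;D$ denotes composition in diagrammatic order, $X\rtimes C$ and $C\ltimes X$ the two whiskerings, $\mathbf i$ the unit. A *circuit algebra* $\mathcal E$ is a strict symmetric premonoidal category whose hom-sets carry preorders $\lesssim$ for which composition and whiskering are monotone. An *abstraction* $\alpha:\mathcal M\to\mathcal E$ is a strict symmetric premonoidal functor. An *effect annotation* is a morphism $e:\mathtt t\to\mathtt s$ of $\mathcal E$; annotations are comparable only if they have the same endpoints. Put $\varepsilon=\mathrm{id}_{\mathbf i}$. Fix a set of wire types $w$, each interpreted by an object $\llbracket w\rrbracket$ of $\mathcal M$; a list of wire types denotes the tensor of its members. Write $\mathcal M^{\lesssim e}(S,S')$ for the set of circuits $C:S\to S'$ with $\alpha(C)\lesssim e$. **Syntax.** Bundle types are $T,U::=\mathbb 1\mid w\mid T\otimes U$; types are $$A,B::=\mathbb 1\mid\mathsf{Nat}\mid w\mid A\otimes B\mid A\multimap_{S}^{e}B\mid\,!_eA\mid\mathsf{Circ}_e(T,U)$$ with $S$ a list of wire types (the wires captured by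 a closure). Parameter types are $\mathbb 1$, $\mathsf{Nat}$, $!_eA$, $\mathsf{Circ}_e(T,U)$ and tensors of parameter types. The circuit part $\sharp A$ of a type is: the empty list for $\mathbb 1,\mathsf{Nat},!_eA,\mathsf{Circ}_e(T,U)$; $\sharp w=w$; $\sharp(A\otimes B)=\sharp A\,\sharp B$; $\sharp(A\multimap^e_SB)=S$. Values are $$V,W::=*\mid n\mid\ell\mid x\mid\lambda x^A.M\mid\mathsf{lift}\,M\mid(\vec\ell,C,\vec k)\mid\langle V,W\rangle$$ where $\ell$ is a label and $(\vec\ell,C,\vec k)$ is a boxed circuit: $C$ is a circuit from a label context $Q$ to a label context $L$, and $\vec\ell,\vec k$ are bundles of labels. Terms are $$M,N::=V\,W\mid\mathsf{let}\,\langle x,y\rangle=V\,\mathsf{in}\,M\mid\mathsf{force}\,V\mid\mathsf{box}_T\,V\mid\mathsf{apply}(V,W)\mid\mathsf{ifz}\,V\,M\,N\mid\mathsf{return}\,V\mid\mathsf{let}\,x=M\,\mathsf{in}\,N.$$ **Typing.** A typing context is a list of typed variables and labels with distinct names; $\Phi$ stands for contexts of variables of parameter type; $\sharp\Gamma$ is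 the concatenation of the circuit parts. Values: - $\Phi\vdash *:\mathbb 1$; $\ \Phi\vdash n:\mathsf{Nat}$; $\ \Phi,\ell:w\vdash\ell:w$; $\ \Phi,x:A\vdash x:A$; - if $\Gamma,x:A\vdash M:B;e$, then $\Gamma\vdash\lambda x^A.M:A\multimap^e_{\sharp\Gamma}B$; if $\Phi\vdash M:A;e$, then $\Phi\vdash\mathsf{lift}\,M:\,!_eA$; - if $C:Q\to L$, $Q'\cong Q$ and $L\cong L'$ are permutations of label contexts, $Q'\vdash\vec\ell:T$ and $L'\vdash\vec k:U$, then $\Phi\vdash(\vec\ell,C,\vec k):\mathsf{Circ}_e(T,U)$ with $e=\alpha(\llbracket(\vec\ell,C,\vec k)\rrbracket)$, where $\llbracket(\vec\ell,C,\vec k)\rrbracket:T\to U$ is $C$ precomposed and postcomposed with these permutations; - if $\Phi,\Gamma_1\vdash V:A$ and $\Phi,\Gamma_2\vdash W:B$, then $\Phi,\Gamma_1,\Gamma_2\vdash\langle V,W\rangle:A\otimes B$. Terms: - if $\Phi,\Gamma_1\vdash V:A\multimap^e_SB$ and $\Phi,\Gamma_2\vdash W:A$, then $\Phi,\Gamma_1,\Gamma_2\vdash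 V\,W:B;e$; if $\Phi\vdash V:\,!_eA$, then $\Phi\vdash\mathsf{force}\,V:A;e$; - if $\Phi\vdash V:T\multimap^e_{\mathbb 1}U$ (no captured wires), then $\Phi\vdash\mathsf{box}_TV:\mathsf{Circ}_e(T,U);\varepsilon$; if $\Phi,\Gamma_1\vdash V:\mathsf{Circ}_e(T,U)$ and $\Phi,\Gamma_2\vdash W:T$, then $\Phi,\Gamma_1,\Gamma_2\vdash\mathsf{apply}(V,W):U;e$; - if $\Phi,\Gamma_1\vdash V:A\otimes B$ and $\Phi,\Gamma_2,x:A,y:B\vdash M:D;e$, then $\Phi,\Gamma_2,\Gamma_1\vdash\mathsf{let}\,\langle x,y\rangle=V\,\mathsf{in}\,M:D;e$; - if $\Phi\vdash V:\mathsf{Nat}$, $\Phi,\Gamma\vdash M:A;e$ and $\Phi,\Gamma\vdash N:A;e$, then $\Phi,\Gamma\vdash\mathsf{ifz}\,V\,M\,N:A;e$; - if $\Gamma\vdash V:A$, then $\Gamma\vdash\mathsf{return}\,V:A;\mathrm{id}_{\alpha(\sharp A)}$; - if $\Phi,\Gamma_1\vdash M:A;e_1$ and $\Phi,\Gamma_2,x:A\vdash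 N:B;e_2$, then $\Phi,\Gamma_2,\Gamma_1\vdash\mathsf{let}\,x=M\,\mathsf{in}\,N:B;(\mathrm{id}_{\alpha(\sharp\Gamma_2)}\rtimes e_1);e_2$; - if $\Gamma\vdash M:A;e_1$ and $e_1\lesssim e_2$, then $\Gamma\vdash M:A;e_2$; - if $\Gamma_1,a,b,\Gamma_2\vdash M:A;e$, then $\Gamma_1,b,a,\Gamma_2\vdash M:A;\alpha(\mathbf{perm});e$, where $\mathbf{perm}:\sharp(\Gamma_1,b,a,\Gamma_2)\to\sharp(\Gamma_1,a,b,\Gamma_2)$ is the symmetry. **Configurations.** A configuration $(C,M)$ consists of a circuit $C:Q\to L_0$ between label contexts and a term $M$. One writes $Q\vdash(C,M):A;Q';e$ if $L_0=L,Q'$ (with distinct labels) and $L\vdash M:A;e$, and similarly $Q\vdash(C,V):A;Q'$ for a value $V$. The big-step relation $(C,M)\Downarrow(D,V)$ is the least one such that - $(C,\mathsf{return}\,V)\Downarrow(C,V)$; - application of $\lambda x^A.M$, destructuring of pairs, $\mathsf{force}(\mathsf{lift}\,M)$ and $\mathsf{ifz}$ (first branch on $0$, second on $n+1$) are evaluated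 by the usual $\beta$-rules; - if $(C,M)\Downarrow(C',W)$ and $(C',N[W/x])\Downarrow(D,V)$, then $(C,\mathsf{let}\,x=M\,\mathsf{in}\,N)\Downarrow(D,V)$; - if $P\vdash\vec\ell:T$ is a bundle of fresh labels and $(\mathrm{id}_P,V\,\vec\ell\,)\Downarrow(D,\vec k)$, then $(C,\mathsf{box}_TV)\Downarrow(C,(\vec\ell,D,\vec k))$; - $(C,\mathsf{apply}((\vec\ell,F,\vec k),\vec t\,))\Downarrow(C',\vec k')$, where $C'$ is obtained from $C$ by permuting its outputs so that the labels of $\vec t$ come first, followed by the remaining labels $R$, and then composing with $\llbracket(\vec\ell,F,\vec k)\rrbracket\ltimes R$; the new outputs are named by fresh labels $\vec k'$. **Semantics.** Define sets $\flat A$ by $\flat\mathbb 1=\flat w=\{*\}$, $\flat\mathsf{Nat}=\mathbb N$, $\flat(A\otimes B)=\flat A\times\flat B$, $\flat(A\multimap^e_SB)=\big(\flat A\to\flat B\times\mathcal M^{\lesssim e}(S\,\sharp A,\sharp B)\big)$, $\flat(!_eA)=\flat A\times\mathcal M^{\lesssim e}(\mathbf i,\sharp A)$, $\flat\,\mathsf{Circ}_e(T,U)=\mathcal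 M^{\lesssim e}(T,U)$, and $\flat\Gamma$ as the product over the entries of $\Gamma$. A derivation of $\Gamma\vdash V:A$ forces $\sharp\Gamma=\sharp A$ and is interpreted by a function $\flat\Gamma\to\flat A$; a derivation of $\Gamma\vdash M:A;e$ is interpreted by a function $\flat\Gamma\to\flat A\times\mathcal M^{\lesssim e}(\sharp\Gamma,\sharp A)$. Both are defined by recursion on the derivation: $\lambda$, $\mathsf{lift}$ are currying and thunking, and application, $\mathsf{force}$ and the conditional are the evident operations; a boxed circuit denotes $\llbracket(\vec\ell,C,\vec k)\rrbracket$; $\mathsf{return}\,V$ gives the value of $V$ and the identity circuit; $\mathsf{box}_T V$ gives the circuit component of $V$ at the unique element of $\flat T$, and the empty circuit; $\mathsf{apply}$ gives the unique element of $\flat U$ and the boxed circuit; $\mathsf{let}\,x=M\,\mathsf{in}\,N$ gives the circuit $(\sharp\Gamma_2\rtimes C_M);C_N$; subsumption is inclusion; exchange precomposes with $\mathbf{perm}$. For $Q\vdash(C,M):A;Q';e$ with $C:Q\to L,Q'$, the meaning $\llbracket(C,M)\rrbracket$ is the pair $(a,\;C;(C_M\ltimes Q'))$, where $(a,C_M)$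 is the interpretation of $M$; for a value, $\llbracket(D,V)\rrbracket$ is the pair (interpretation of $V$, $D$). $J$ regards a pair $(f,C)$ of a function $f:X\to Y$ and a circuit $C:S\to S'$ as the function $x\mapsto(f(x),C)$ from $X$ to $Y\times\mathcal M^{\lesssim\alpha(C)}(S,S')$. The equality $\llbracket(C,M)\rrbracket=J(\llbracket(D,V)\rrbracket)$ below means equality as functions into pairs of an element and a circuit. **Theorem (Computational adequacy).** Suppose that $\emptyset\vdash(C,M):\mathbb 1;\emptyset;\,e$ with $e:\mathtt t\to\mathbf i$, that $\emptyset\vdash(D,V):\mathbb 1;\emptyset$, and that $\llbracket(C,M)\rrbracket=J(\llbracket(D,V)\rrbracket)$. Then $(C,M)\Downarrow(D,V)$; no renaming of labels is needed, because $D$ has no output labels and $V$ contains no free labels. Moreover there is a circuit $E$, from the outputs of $C$ to the outputs of $D$, such that $\alpha(E)\lesssim e$ and $C;E=D$. -/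

import Mathlib

open CategoryTheory

universe v u v' u' w

namespace ProtoQuipper

/-! ## Strict symmetric premonoidal categories, circuit algebras, abstractions -/

/-- A strict symmetric premonoidal category. `wl X f` is `X ⋊ f`, `wr f X` is `f ⋉ X`; no interchange
law is assumed. Strictness: associators and unitors are identities. -/
class StrictSymPremonoidal (C : Type u) [Category.{v} C] where
  tensor : C → C → C
  unit : C
  wl : ∀ (X : C) {Y Z : C}, (Y ⟶ Z) → (tensor X Y ⟶ tensor X Z)
  wr : ∀ {Y Z : C}, (Y ⟶ Z) → ∀ X : C, (tensor Y X ⟶ tensor Z X)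
  tensor_assoc : ∀ X Y Z : C, tensor (tensor X Y) Z = tensor X (tensor Y Z)
  unit_tensor : ∀ X : C, tensor unit X = X
  tensor_unit : ∀ X : C, tensor X unit = X
  wl_id : ∀ X Y : C, wl X (𝟙 Y) = 𝟙 (tensor X Y)
  wl_comp : ∀ (X : C) {Y Z T : C} (f : Y ⟶ Z) (g : Z ⟶ T), wl X (f ≫ g) = wl X f ≫ wl X g
  wr_id : ∀ X Y : C, wr (𝟙 Y) X = 𝟙 (tensor Y X)
  wr_comp : ∀ {Y Z T : C} (f : Y ⟶ Z) (g : Z ⟶ T) (X : C), wr (f ≫ g) X = wr f X ≫ wr g X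
  wl_unit : ∀ {Y Z : C} (f : Y ⟶ Z), HEq (wl unit f) f
  wr_unit : ∀ {Y Z : C} (f : Y ⟶ Z), HEq (wr f unit) f
  wl_tensor : ∀ (X X' : C) {Y Z : C} (f : Y ⟶ Z), HEq (wl (tensor X X') f) (wl X (wl X' f))
  wr_tensor : ∀ {Y Z : C} (f : Y ⟶ Z) (X X' : C), HEq (wr f (tensor X X')) (wr (wr f X) X')
  wr_wl : ∀ (X : C) {Y Z : C} (f : Y ⟶ Z) (X' : C), HEq (wr (wl X f) X') (wl X (wr f X'))
  /-- the symmetry -/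
  braid : ∀ X Y : C, tensor X Y ⟶ tensor Y X
  braid_braid : ∀ X Y : C, braid X Y ≫ braid Y X = 𝟙 (tensor X Y)
  braid_natural : ∀ {X Y : C} (f : X ⟶ Y) (Z : C), wr f Z ≫ braid Y Z = braid X Z ≫ wl Z f
  /-- the symmetry is a central morphism (two conditions) -/
  braid_central_left : ∀ (X Y : C) {Z T : C} (g : Z ⟶ T),
    wr (braid X Y) Z ≫ wl (tensor Y X) g = wl (tensor X Y) g ≫ wr (braid X Y) T
  braid_central_right : ∀ (X Y : C) {Z T : C} (g : Z ⟶ T),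
    wl Z (braid X Y) ≫ wr g (tensor Y X) = wr g (tensor X Y) ≫ wl T (braid X Y)
  braid_tensor : ∀ X Y Z : C,
    braid X (tensor Y Z) =
      eqToHom (tensor_assoc X Y Z).symm ≫ wr (braid X Y) Z ≫ eqToHom (tensor_assoc Y X Z) ≫
        wl Y (braid X Z) ≫ eqToHom (tensor_assoc Y Z X).symm

open StrictSymPremonoidal

/-- A circuit algebra: a preorder-enriched strict symmetric premonoidal category. -/
class CircuitAlgebra (E : Type u) [Category.{v} E] extends StrictSymPremonoidal E where
  homPreorder : ∀ t s : E, Preorder (t ⟶ s)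
  comp_mono : ∀ {t s r : E} (e₁ d₁ : t ⟶ s) (e₂ d₂ : s ⟶ r),
    e₁ ≤ d₁ → e₂ ≤ d₂ → e₁ ≫ e₂ ≤ d₁ ≫ d₂
  wl_mono : ∀ (r : E) {t s : E} (e d : t ⟶ s), e ≤ d → wl r e ≤ wl r d
  wr_mono : ∀ (r : E) {t s : E} (e d : t ⟶ s), e ≤ d → wr e r ≤ wr d r

instance {E : Type u} [Category.{v} E] [CircuitAlgebra E] (t s : E) : Preorder (t ⟶ s) :=
  CircuitAlgebra.homPreorder t s

/-- An abstraction: a strict symmetric premonoidal functor from circuits to a circuit algebra. -/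
structure Abstraction (M : Type u) [Category.{v} M] [StrictSymPremonoidal M]
    (E : Type u') [Category.{v'} E] [CircuitAlgebra E] extends M ⥤ E where
  obj_unit : obj unit = unit
  obj_tensor : ∀ X Y : M, obj (tensor X Y) = tensor (obj X) (obj Y)
  map_wl : ∀ (X : M) {Y Z : M} (f : Y ⟶ Z), HEq (map (wl X f)) (wl (obj X) (map f))
  map_wr : ∀ {Y Z : M} (f : Y ⟶ Z) (X : M), HEq (map (wr f X)) (wr (map f) (obj X))
  map_braid : ∀ X Y : M, HEq (map (braid X Y)) (braid (obj X) (obj Y))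

/-- An effect annotation `e : t ⟶ s`, together with its domain and codomain. -/
structure Eff (E : Type u) [Category.{v} E] where
  dom : E
  cod : E
  hom : dom ⟶ cod

/-- The order on effect annotations; only annotations with the same endpoints are comparable. -/
inductive Eff.Le {E : Type u} [Category.{v} E] [CircuitAlgebra E] : Eff E → Eff E → Prop
  | mk {t s : E} {e d : t ⟶ s} (h : e ≤ d) : Eff.Le ⟨t, s, e⟩ ⟨t, s, d⟩

/-- The null effect: the identity on the monoidal unit. -/
def Eff.null (E : Type u) [Category.{v} E] [CircuitAlgebra E] : Eff E := ⟨unit, unit, 𝟙 _⟩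

theorem Eff.Le.refl {E : Type u} [Category.{v} E] [CircuitAlgebra E] (e : Eff E) : Eff.Le e e :=
  ⟨le_refl e.hom⟩

theorem Eff.Le.trans {E : Type u} [Category.{v} E] [CircuitAlgebra E] {e d f : Eff E}
    (h : Eff.Le e d) (h' : Eff.Le d f) : Eff.Le e f := by
  cases h with
  | mk h => cases h' with
    | mk h' => exact ⟨le_trans h h'⟩

/-! ## Types -/

/-- Bundle types over the wire types `W`. -/
inductive BTy (W : Type w) where
  | unit : BTy W
  | wire : W → BTy W
  | tensor : BTy W → BTy W → BTy W

/-- The list of wires of a bundle type. -/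
def BTy.wires {W : Type w} : BTy W → List W
  | .unit => []
  | .wire a => [a]
  | .tensor T U => T.wires ++ U.wires

/-- Types. In `arrow A B S e` the list `S` is the bundle type of the captured wires (a bundle type up
to the unit and associativity laws of the tensor is a list of wire types). -/
inductive Ty (W : Type w) (E : Type u') [Category.{v'} E] where
  | unit : Ty W E
  | nat : Ty W E
  | wire : W → Ty W E
  | tensor : Ty W E → Ty W E → Ty W E
  | arrow : Ty W E → Ty W E → List W → Eff E → Ty W E
  | bang : Ty W E → Eff E → Ty W E
  | circ : BTy W → BTy W → Eff E → Ty W E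

section Grammar

variable {W : Type w} {E : Type u'} [Category.{v'} E]

/-- Bundle types as types. -/
def BTy.toTy : BTy W → Ty W E
  | .unit => .unit
  | .wire a => .wire a
  | .tensor T U => .tensor T.toTy U.toTy

/-- Parameter types. -/
def Ty.IsParam : Ty W E → Prop
  | .unit => True
  | .nat => True
  | .wire _ => False
  | .tensor A B => A.IsParam ∧ B.IsParam
  | .arrow _ _ _ _ => False
  | .bang _ _ => True
  | .circ _ _ _ => True

/-- `♯A`: the circuit part of a type. -/
def Ty.sharp : Ty W E → List W
  | .unit => []
  | .nat => []
  | .wire a => [a]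
  | .tensor A B => A.sharp ++ B.sharp
  | .arrow _ _ S _ => S
  | .bang _ _ => []
  | .circ _ _ _ => []

theorem Ty.IsParam.sharp_eq : ∀ {A : Ty W E}, A.IsParam → A.sharp = []
  | .unit, _ => rfl
  | .nat, _ => rfl
  | .tensor A B, h => by
      simp only [Ty.sharp, Ty.IsParam.sharp_eq (A := A) h.1, Ty.IsParam.sharp_eq (A := B) h.2,
        List.append_nil]
  | .bang _ _, _ => rfl
  | .circ _ _ _, _ => rfl

theorem BTy.sharp_toTy : ∀ T : BTy W, (T.toTy : Ty W E).sharp = T.wires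
  | .unit => rfl
  | .wire _ => rfl
  | .tensor T U => by
      simp only [BTy.toTy, Ty.sharp, BTy.wires, BTy.sharp_toTy T, BTy.sharp_toTy U]

/-! ## Label contexts, wire bundles, typing contexts -/

/-- Label contexts: lists of labels (natural numbers) with their wire types. -/
abbrev LCtx (W : Type w) := List (ℕ × W)

/-- The wire types of a label context. -/
def LCtx.wires (Q : LCtx W) : List W := Q.map Prod.snd

/-- The labels of a label context are pairwise distinct. -/
def LCtx.Distinct (Q : LCtx W) : Prop := (Q.map Prod.fst).Nodup

/-- Permutations `Q ≅ Q'` of label contexts. -/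
inductive LPerm : LCtx W → LCtx W → Type w where
  | nil : LPerm [] []
  | cons (a : ℕ × W) {Q Q' : LCtx W} : LPerm Q Q' → LPerm (a :: Q) (a :: Q')
  | swap (a b : ℕ × W) (Q : LCtx W) : LPerm (a :: b :: Q) (b :: a :: Q)
  | trans {Q Q' Q'' : LCtx W} : LPerm Q Q' → LPerm Q' Q'' → LPerm Q Q''

/-- Wire bundles. -/
inductive Bundle where
  | unit : Bundle
  | lab : ℕ → Bundle
  | pair : Bundle → Bundle → Bundle

/-- Typing of wire bundles, `Q ⊢ ℓ : T`. -/
inductive Bundle.HasTy : LCtx W → Bundle → BTy W → Prop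
  | unit : Bundle.HasTy [] .unit .unit
  | lab (l : ℕ) (a : W) : Bundle.HasTy [(l, a)] (.lab l) (.wire a)
  | pair {Q Q' : LCtx W} {l k : Bundle} {T U : BTy W} :
      Bundle.HasTy Q l T → Bundle.HasTy Q' k U →
      Bundle.HasTy (Q ++ Q') (.pair l k) (.tensor T U)

theorem Bundle.HasTy.wires_eq {Q : LCtx W} {l : Bundle} {T : BTy W} (h : l.HasTy Q T) :
    Q.wires = T.wires := by
  induction h with
  | unit => rfl
  | lab l a => rfl
  | pair _ _ ih ih' =>
      simp only [LCtx.wires, List.map_append, BTy.wires] at *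
      rw [ih, ih']

/-- Entries of typing contexts: typed variables, and labels with their wire type. -/
inductive Entry (W : Type w) (E : Type u') [Category.{v'} E] where
  | var : ℕ → Ty W E → Entry W E
  | lab : ℕ → W → Entry W E

def Entry.ty : Entry W E → Ty W E
  | .var _ A => A
  | .lab _ a => .wire a

/-- Variables and labels are two separate name spaces. -/
def Entry.name : Entry W E → ℕ ⊕ ℕ
  | .var x _ => Sum.inl x
  | .lab l _ => Sum.inr l

/-- Typing contexts. -/
abbrev Ctx (W : Type w) (E : Type u') [Category.{v'} E] := List (Entry W E)

/-- The variables and labels of a context are pairwise distinct. -/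
def Ctx.Distinct (Γ : Ctx W E) : Prop := (Γ.map Entry.name).Nodup

/-- Parameter contexts: only variables, of parameter type. -/
def Ctx.IsParam (Φ : Ctx W E) : Prop := ∀ a ∈ Φ, ∃ x A, a = Entry.var x A ∧ A.IsParam

/-- `♯Γ`. -/
def Ctx.sharp (Γ : Ctx W E) : List W := Γ.flatMap fun a => a.ty.sharp

/-- A label context as a typing context. -/
def LCtx.toCtx (Q : LCtx W) : Ctx W E := Q.map fun p => Entry.lab p.1 p.2

theorem Ctx.sharp_append (Γ Δ : Ctx W E) : (Γ ++ Δ : Ctx W E).sharp = Γ.sharp ++ Δ.sharp :=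
  List.flatMap_append

theorem Ctx.sharp_var (x : ℕ) (A : Ty W E) : Ctx.sharp [Entry.var x A] = A.sharp := by
  simp [Ctx.sharp, Entry.ty]

theorem Ctx.IsParam.sharp_eq {Φ : Ctx W E} (h : Φ.IsParam) : Φ.sharp = [] := by
  refine List.flatMap_eq_nil_iff.2 fun a ha => ?_
  obtain ⟨x, A, rfl, hA⟩ := h a ha
  exact hA.sharp_eq

theorem LCtx.sharp_toCtx (Q : LCtx W) : (Q.toCtx : Ctx W E).sharp = Q.wires := by
  induction Q with
  | nil => rfl
  | cons a Q ih =>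
      simp only [LCtx.toCtx, Ctx.sharp, LCtx.wires, List.map_cons, List.flatMap_cons] at *
      rw [ih]; rfl

end Grammar

/-! ## Circuits -/

section Circuits

variable {M : Type u} [Category.{v} M] [StrictSymPremonoidal M] {W : Type w} (ι : W → M)

/-- The object of circuits denoted by a list of wires. -/
def den : List W → M
  | [] => unit
  | a :: S => tensor (ι a) (den S)

theorem den_append (S S' : List W) : den ι (S ++ S') = tensor (den ι S) (den ι S') := by
  induction S with
  | nil => exact (unit_tensor _).symm
  | cons a S ih => simp only [List.cons_append, den, ih, tensor_assoc]

/-- Circuits from the wires `S` to the wires `S'`. -/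
abbrev Circ (S S' : List W) : Type v := den ι S ⟶ den ι S'

/-- The identity circuit between equal lists of wires. -/
def idc {S S' : List W} (h : S = S') : Circ ι S S' := eqToHom (congrArg (den ι) h)

/-- `S ⋊ C` -/
def whiskL (S : List W) {S₁ S₂ : List W} (C : Circ ι S₁ S₂) : Circ ι (S ++ S₁) (S ++ S₂) :=
  eqToHom (den_append ι S S₁) ≫ wl (den ι S) C ≫ eqToHom (den_append ι S S₂).symm

/-- `C ⋉ S` -/
def whiskR {S₁ S₂ : List W} (C : Circ ι S₁ S₂) (S : List W) : Circ ι (S₁ ++ S) (S₂ ++ S) :=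
  eqToHom (den_append ι S₁ S) ≫ wr C (den ι S) ≫ eqToHom (den_append ι S₂ S).symm

/-- The symmetry on lists of wires. -/
def swapc (S S' : List W) : Circ ι (S ++ S') (S' ++ S) :=
  eqToHom (den_append ι S S') ≫ braid (den ι S) (den ι S') ≫ eqToHom (den_append ι S' S).symm

/-- The circuit exchanging two neighbouring groups of wires. -/
def exchange (S₁ S S' S₂ : List W) : Circ ι (S₁ ++ (S ++ (S' ++ S₂))) (S₁ ++ (S' ++ (S ++ S₂))) :=
  whiskL ι S₁ (idc ι (List.append_assoc S S' S₂).symm ≫ whiskR ι (swapc ι S S') S₂ ≫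
    idc ι (List.append_assoc S' S S₂))

/-- The circuit of a permutation of labels. -/
def LPerm.circ : ∀ {Q Q' : LCtx W}, LPerm Q Q' → Circ ι Q.wires Q'.wires
  | _, _, .nil => 𝟙 _
  | _, _, .cons a σ => wl (ι a.2) σ.circ
  | _, _, .swap a b Q =>
      eqToHom (tensor_assoc (ι a.2) (ι b.2) (den ι Q.wires)).symm ≫
        wr (braid (ι a.2) (ι b.2)) (den ι Q.wires) ≫
        eqToHom (tensor_assoc (ι b.2) (ι a.2) (den ι Q.wires))
  | _, _, .trans σ τ => σ.circ ≫ τ.circ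

/-- A circuit with input label context `Q` and output label context `cod`. -/
structure LCirc (Q : LCtx W) where
  cod : LCtx W
  hom : Circ ι Q.wires cod.wires

/-- The circuit `⟦(ℓ, C, k)⟧ : ⟦T⟧ ⟶ ⟦U⟧` of a boxed circuit: the labels of `C : Q → L` are permuted
into the order in which they occur in the bundles `ℓ` and `k`. -/
def boxMor {Q Q' L L' : LCtx W} {l k : Bundle} {T U : BTy W} (σ : LPerm Q' Q) (τ : LPerm L L')
    (hl : l.HasTy Q' T) (hk : k.HasTy L' U) (C : Circ ι Q.wires L.wires) :
    Circ ι T.wires U.wires :=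
  idc ι hl.wires_eq.symm ≫ σ.circ ι ≫ C ≫ τ.circ ι ≫ idc ι hk.wires_eq

/-! ## Terms and values -/

variable (E : Type u') [Category.{v'} E]

mutual
/-- Values. `boxed l Q L C k` is the boxed circuit `(l, C, k)` with `C : Q → L`. -/
inductive Val where
  | unit : Val
  | nat : ℕ → Val
  | lab : ℕ → Val
  | var : ℕ → Val
  | abs : ℕ → Ty W E → Tm → Val
  | lift : Tm → Val
  | boxed (l : Bundle) (Q L : LCtx W) (C : Circ ι Q.wires L.wires) (k : Bundle) : Val
  | pair : Val → Val → Val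
/-- Terms (computations). `letin x M N` is `let x = M in N`, `dest x y V M` is
`let ⟨x, y⟩ = V in M`. -/
inductive Tm where
  | app : Val → Val → Tm
  | dest : ℕ → ℕ → Val → Tm → Tm
  | force : Val → Tm
  | box : BTy W → Val → Tm
  | apply : Val → Val → Tm
  | ifz : Val → Tm → Tm → Tm
  | ret : Val → Tm
  | letin : ℕ → Tm → Tm → Tm
end

variable {ι E}

/-- Wire bundles as values. -/
def Bundle.toVal : Bundle → Val ι E
  | .unit => .unit
  | .lab l => .lab l
  | .pair l k => .pair l.toVal k.toVal

mutual
/-- Substitution `W[X/x]`. It is only used for values `X` without free variables, so that bound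
variables need not be renamed. -/
def Val.subst (x : ℕ) (X : Val ι E) : Val ι E → Val ι E
  | .unit => .unit
  | .nat n => .nat n
  | .lab l => .lab l
  | .var y => if y = x then X else .var y
  | .abs y A M => .abs y A (if y = x then M else Tm.subst x X M)
  | .lift M => .lift (Tm.subst x X M)
  | .boxed l Q L C k => .boxed l Q L C k
  | .pair V V' => .pair (Val.subst x X V) (Val.subst x X V')
/-- Substitution `M[X/x]`. -/
def Tm.subst (x : ℕ) (X : Val ι E) : Tm ι E → Tm ι E
  | .app V V' => .app (Val.subst x X V) (Val.subst x X V')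
  | .dest y z V M =>
      .dest y z (Val.subst x X V) (if y = x ∨ z = x then M else Tm.subst x X M)
  | .force V => .force (Val.subst x X V)
  | .box T V => .box T (Val.subst x X V)
  | .apply V V' => .apply (Val.subst x X V) (Val.subst x X V')
  | .ifz V M N => .ifz (Val.subst x X V) (Tm.subst x X M) (Tm.subst x X N)
  | .ret V => .ret (Val.subst x X V)
  | .letin y M N =>
      .letin y (Tm.subst x X M) (if y = x then N else Tm.subst x X N)
end

/-! ## Operational semantics -/

/-- Appending a circuit `F : T ⟶ U` to `C`: the outputs of `C` are permuted so that the wires of type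
`T` come first, followed by the remaining wires `R`; then `F` acts on the former. `K` is the label
context of the new wires. -/
def LCirc.append {Q : LCtx W} (C : LCirc ι Q) {Lt R K : LCtx W} {t k : Bundle} {T U : BTy W}
    (π : LPerm C.cod (Lt ++ R)) (ht : t.HasTy Lt T) (hk : k.HasTy K U)
    (F : Circ ι T.wires U.wires) : LCirc ι Q where
  cod := K ++ R
  hom := C.hom ≫ π.circ ι ≫ idc ι (List.map_append ..) ≫
    whiskR ι (idc ι ht.wires_eq ≫ F ≫ idc ι hk.wires_eq.symm) R.wires ≫
    idc ι (List.map_append ..).symm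

/-- Big-step evaluation `(C, M) ⇓ (D, V)` of configurations. Fresh labels are chosen arbitrarily. -/
inductive Eval : ∀ {Q : LCtx W}, LCirc ι Q → Tm ι E → LCirc ι Q → Val ι E → Prop
  | app {Q : LCtx W} {C D : LCirc ι Q} {x : ℕ} {A : Ty W E} {M : Tm ι E} {X V : Val ι E} :
      Eval C (M.subst x X) D V → Eval C (.app (.abs x A M) X) D V
  | dest {Q : LCtx W} {C D : LCirc ι Q} {x y : ℕ} {M : Tm ι E} {X Y V : Val ι E} :
      Eval C ((M.subst x X).subst y Y) D V → Eval C (.dest x y (.pair X Y) M) D V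
  | force {Q : LCtx W} {C D : LCirc ι Q} {M : Tm ι E} {V : Val ι E} :
      Eval C M D V → Eval C (.force (.lift M)) D V
  | ifz_zero {Q : LCtx W} {C D : LCirc ι Q} {M N : Tm ι E} {V : Val ι E} :
      Eval C M D V → Eval C (.ifz (.nat 0) M N) D V
  | ifz_succ {Q : LCtx W} {C D : LCirc ι Q} {n : ℕ} {M N : Tm ι E} {V : Val ι E} :
      Eval C N D V → Eval C (.ifz (.nat (n + 1)) M N) D V
  | ret {Q : LCtx W} {C : LCirc ι Q} {V : Val ι E} : Eval C (.ret V) C V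
  | letin {Q : LCtx W} {C C' D : LCirc ι Q} {x : ℕ} {M N : Tm ι E} {X V : Val ι E} :
      Eval C M C' X → Eval C' (N.subst x X) D V → Eval C (.letin x M N) D V
  /-- `V` is run on fresh labels `l : T`, starting from the identity circuit. -/
  | box {Q : LCtx W} {C : LCirc ι Q} {T : BTy W} {V : Val ι E} {P : LCtx W} {l k : Bundle}
      {D : LCirc ι P} :
      l.HasTy P T → P.Distinct →
      Eval ⟨P, 𝟙 _⟩ (.app V l.toVal) D k.toVal →
      Eval C (.box T V) C (.boxed l P D.cod D.hom k)
  /-- The boxed circuit is appended to the wires `t`; the new outputs `k'` get fresh labels. -/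
  | apply {Q : LCtx W} {C : LCirc ι Q} {P P' L L' Lt R K : LCtx W} {l k t k' : Bundle}
      {T U : BTy W} {F : Circ ι P.wires L.wires}
      (hP : P.Distinct) (hL : L.Distinct) (σ : LPerm P' P) (τ : LPerm L L')
      (hl : l.HasTy P' T) (hk : k.HasTy L' U)
      (hC : C.cod.Distinct) (π : LPerm C.cod (Lt ++ R)) (ht : t.HasTy Lt T)
      (hk' : k'.HasTy K U) (hK : LCtx.Distinct (K ++ R)) :
      Eval C (.apply (.boxed l P L F k) t.toVal)
        (C.append π ht hk' (boxMor ι σ τ hl hk F)) k'.toVal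

end Circuits

/-! ## The type-and-effect system -/

section Effects

variable {M : Type u} [Category.{v} M] [StrictSymPremonoidal M]
  {E : Type u'} [Category.{v'} E] [CircuitAlgebra E] (α : Abstraction M E)

/-- The effect annotation `α(C)` of a circuit. -/
def Abstraction.eff {X Y : M} (C : X ⟶ Y) : Eff E := ⟨α.obj X, α.obj Y, α.map C⟩

variable {W : Type w} {ι : W → M}

mutual
/-- Derivations of value judgments `Γ ⊢ V : A`. -/
inductive VTy : Ctx W E → Val ι E → Ty W E → Type (max u u' v v' w)
  | unit {Φ : Ctx W E} : Φ.IsParam → Φ.Distinct → VTy Φ .unit .unit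
  | nat {Φ : Ctx W E} (n : ℕ) : Φ.IsParam → Φ.Distinct → VTy Φ (.nat n) .nat
  | lab {Φ : Ctx W E} (l : ℕ) (a : W) : Φ.IsParam → Ctx.Distinct (Φ ++ [.lab l a]) →
      VTy (Φ ++ [.lab l a]) (.lab l) (.wire a)
  | var {Φ : Ctx W E} (x : ℕ) (A : Ty W E) : Φ.IsParam → Ctx.Distinct (Φ ++ [.var x A]) →
      VTy (Φ ++ [.var x A]) (.var x) A
  | abs {Γ : Ctx W E} {x : ℕ} {A B : Ty W E} {N : Tm ι E} {e : Eff E} :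
      CTy (Γ ++ [.var x A]) N B e → VTy Γ (.abs x A N) (.arrow A B Γ.sharp e)
  | lift {Φ : Ctx W E} {A : Ty W E} {N : Tm ι E} {e : Eff E} :
      Φ.IsParam → CTy Φ N A e → VTy Φ (.lift N) (.bang A e)
  | circ {Φ : Ctx W E} {Q Q' L L' : LCtx W} {l k : Bundle} {T U : BTy W}
      (C : Circ ι Q.wires L.wires) (hΦ : Φ.IsParam) (hΦd : Φ.Distinct)
      (hQ : Q.Distinct) (hL : L.Distinct) (σ : LPerm Q' Q) (τ : LPerm L L')
      (hl : l.HasTy Q' T) (hk : k.HasTy L' U) :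
      VTy Φ (.boxed l Q L C k) (.circ T U (α.eff (boxMor ι σ τ hl hk C)))
  | pair {Φ Γ₁ Γ₂ : Ctx W E} {V V' : Val ι E} {A B : Ty W E} :
      Φ.IsParam → Ctx.Distinct (Φ ++ Γ₁ ++ Γ₂) →
      VTy (Φ ++ Γ₁) V A → VTy (Φ ++ Γ₂) V' B →
      VTy (Φ ++ Γ₁ ++ Γ₂) (.pair V V') (.tensor A B)
/-- Derivations of computation judgments `Γ ⊢ N : A ; e`. -/
inductive CTy : Ctx W E → Tm ι E → Ty W E → Eff E → Type (max u u' v v' w)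
  | app {Φ Γ₁ Γ₂ : Ctx W E} {V V' : Val ι E} {A B : Ty W E} {S : List W} {e : Eff E} :
      Φ.IsParam → Ctx.Distinct (Φ ++ Γ₁ ++ Γ₂) →
      VTy (Φ ++ Γ₁) V (.arrow A B S e) → VTy (Φ ++ Γ₂) V' A →
      CTy (Φ ++ Γ₁ ++ Γ₂) (.app V V') B e
  | force {Φ : Ctx W E} {V : Val ι E} {A : Ty W E} {e : Eff E} :
      Φ.IsParam → VTy Φ V (.bang A e) → CTy Φ (.force V) A e
  | box {Φ : Ctx W E} {V : Val ι E} {T U : BTy W} {e : Eff E} :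
      Φ.IsParam → VTy Φ V (.arrow T.toTy U.toTy [] e) →
      CTy Φ (.box T V) (.circ T U e) (Eff.null E)
  | apply {Φ Γ₁ Γ₂ : Ctx W E} {V V' : Val ι E} {T U : BTy W} {e : Eff E} :
      Φ.IsParam → Ctx.Distinct (Φ ++ Γ₁ ++ Γ₂) →
      VTy (Φ ++ Γ₁) V (.circ T U e) → VTy (Φ ++ Γ₂) V' T.toTy →
      CTy (Φ ++ Γ₁ ++ Γ₂) (.apply V V') U.toTy e
  | dest {Φ Γ₁ Γ₂ : Ctx W E} {V : Val ι E} {x y : ℕ} {N : Tm ι E} {A B D : Ty W E} {e : Eff E} :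
      Φ.IsParam → Ctx.Distinct (Φ ++ Γ₂ ++ Γ₁) →
      VTy (Φ ++ Γ₁) V (.tensor A B) → CTy (Φ ++ Γ₂ ++ [.var x A, .var y B]) N D e →
      CTy (Φ ++ Γ₂ ++ Γ₁) (.dest x y V N) D e
  | ifz {Φ Γ : Ctx W E} {V : Val ι E} {N N' : Tm ι E} {A : Ty W E} {e : Eff E} :
      Φ.IsParam → VTy Φ V .nat → CTy (Φ ++ Γ) N A e → CTy (Φ ++ Γ) N' A e →
      CTy (Φ ++ Γ) (.ifz V N N') A e
  | ret {Γ : Ctx W E} {V : Val ι E} {A : Ty W E} :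
      VTy Γ V A → CTy Γ (.ret V) A ⟨_, _, 𝟙 (α.obj (den ι A.sharp))⟩
  | letin {Φ Γ₁ Γ₂ : Ctx W E} {x : ℕ} {N N' : Tm ι E} {A B : Ty W E} {t₁ s₁ s₂ : E}
      {e₁ : t₁ ⟶ s₁} {e₂ : tensor (α.obj (den ι Γ₂.sharp)) s₁ ⟶ s₂} :
      Φ.IsParam → Ctx.Distinct (Φ ++ Γ₂ ++ Γ₁) →
      CTy (Φ ++ Γ₁) N A ⟨_, _, e₁⟩ → CTy (Φ ++ Γ₂ ++ [.var x A]) N' B ⟨_, _, e₂⟩ →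
      CTy (Φ ++ Γ₂ ++ Γ₁) (.letin x N N') B ⟨_, _, wl (α.obj (den ι Γ₂.sharp)) e₁ ≫ e₂⟩
  | sub {Γ : Ctx W E} {N : Tm ι E} {A : Ty W E} {t s : E} {e₁ e₂ : t ⟶ s} :
      CTy Γ N A ⟨t, s, e₁⟩ → e₁ ≤ e₂ → CTy Γ N A ⟨t, s, e₂⟩
  | ex {Γ₁ Γ₂ : Ctx W E} {a b : Entry W E} {N : Tm ι E} {A : Ty W E} {s : E}
      {e : α.obj (den ι (Γ₁.sharp ++ (a.ty.sharp ++ (b.ty.sharp ++ Γ₂.sharp)))) ⟶ s} :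
      CTy (Γ₁ ++ a :: b :: Γ₂) N A ⟨_, _, e⟩ →
      CTy (Γ₁ ++ b :: a :: Γ₂) N A
        ⟨_, _, α.map (exchange ι Γ₁.sharp b.ty.sharp a.ty.sharp Γ₂.sharp) ≫ e⟩
end


/-! ## Circuits bounded by an effect annotation -/

/-- The set of circuits `C : S → S'` with `α(C) ≲ e`. -/
abbrev Bounded (ι : W → M) (S S' : List W) (e : Eff E) : Type v :=
  {C : Circ ι S S' // Eff.Le (α.eff C) e}

theorem Abstraction.eff_eqToHom_comp {X X' Y : M} (h : X = X') (C : X' ⟶ Y) :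
    α.eff (eqToHom h ≫ C) = α.eff C := by
  subst h; simp

theorem Abstraction.eff_comp_eqToHom {X Y Y' : M} (C : X ⟶ Y) (h : Y = Y') :
    α.eff (C ≫ eqToHom h) = α.eff C := by
  subst h; simp

theorem Eff.ext_heq {E : Type u'} [Category.{v'} E] {e d : Eff E} (h₁ : e.dom = d.dom) (h₂ : e.cod = d.cod)
    (h : HEq e.hom d.hom) : e = d := by
  cases e; cases d; cases h₁; cases h₂; cases h; rfl

theorem Abstraction.eff_wl (X : M) {Y Z : M} (C : Y ⟶ Z) :
    α.eff (wl X C) = ⟨_, _, wl (α.obj X) (α.map C)⟩ :=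
  Eff.ext_heq (α.obj_tensor _ _) (α.obj_tensor _ _) (α.map_wl X C)

theorem Eff.le_iff {t s t' s' : E} {e : t ⟶ s} {d : t' ⟶ s'} :
    Eff.Le ⟨t, s, e⟩ ⟨t', s', d⟩ ↔
      ∃ (h₁ : t = t') (h₂ : s = s'), e ≤ eqToHom h₁ ≫ d ≫ eqToHom h₂.symm := by
  constructor
  · rintro ⟨h⟩
    exact ⟨rfl, rfl, by simpa using h⟩
  · rintro ⟨h₁, h₂, h⟩
    subst h₁ h₂
    exact ⟨by simpa using h⟩

theorem Abstraction.le_wl_comp {X Y Z T : M} {C : Y ⟶ Z} {D : tensor X Z ⟶ T} {t s r : E}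
    {e₁ : t ⟶ s} {e₂ : tensor (α.obj X) s ⟶ r}
    (h₁ : Eff.Le (α.eff C) ⟨t, s, e₁⟩) (h₂ : Eff.Le (α.eff D) ⟨_, _, e₂⟩) :
    Eff.Le (α.eff (wl X C ≫ D)) ⟨_, _, wl (α.obj X) e₁ ≫ e₂⟩ := by
  obtain ⟨ht, hs, h₁⟩ := Eff.le_iff.1 h₁
  obtain ⟨hs', hr, h₂⟩ := Eff.le_iff.1 h₂
  subst ht hs hr
  have h₃ : α.map (wl X C) =
      eqToHom (α.obj_tensor X Y) ≫ wl (α.obj X) (α.map C) ≫ eqToHom (α.obj_tensor X Z).symm :=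
    (conj_eqToHom_iff_heq' _ _ _ _).2 (α.map_wl X C)
  have h₁' : α.map C ≤ e₁ := by simpa using h₁
  have h₂' : α.map D ≤ eqToHom hs' ≫ e₂ := by simpa using h₂
  refine Eff.le_iff.2 ⟨α.obj_tensor X Y, rfl, ?_⟩
  simp only [eqToHom_refl, Category.comp_id, Functor.map_comp, h₃, Category.assoc]
  refine CircuitAlgebra.comp_mono _ _ _ _ le_rfl
    (CircuitAlgebra.comp_mono _ _ _ _ (CircuitAlgebra.wl_mono _ _ _ h₁') ?_)
  have h₄ := CircuitAlgebra.comp_mono _ _ _ _ (le_refl (eqToHom (α.obj_tensor X Z).symm)) h₂'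
  simpa using h₄

theorem Abstraction.le_comp {X Y Z : M} (C : X ⟶ Y) {D : Y ⟶ Z} {s : E} {e : α.obj Y ⟶ s}
    (h : Eff.Le (α.eff D) ⟨_, _, e⟩) : Eff.Le (α.eff (C ≫ D)) ⟨_, _, α.map C ≫ e⟩ := by
  obtain ⟨hs, hr, h⟩ := Eff.le_iff.1 h
  subst hr
  have h' : α.map D ≤ e := by simpa using h
  refine Eff.le_iff.2 ⟨rfl, rfl, ?_⟩
  simp only [eqToHom_refl, Category.comp_id, Category.id_comp, Functor.map_comp]
  exact CircuitAlgebra.comp_mono _ _ _ _ le_rfl h'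

namespace Bounded

variable {α} {S S' S₁ S₁' : List W} {e : Eff E}

/-- Replacing the interfaces of a circuit by equal lists of wires. -/
def cast (C : Bounded α ι S S' e) (h : S₁ = S) (h' : S' = S₁') : Bounded α ι S₁ S₁' e :=
  ⟨idc ι h ≫ C.1 ≫ idc ι h', by
    rw [idc, idc, Abstraction.eff_eqToHom_comp, Abstraction.eff_comp_eqToHom]; exact C.2⟩

/-- The inclusion for `e ≲ e'`. -/
def weaken (C : Bounded α ι S S' e) {e' : Eff E} (h : Eff.Le e e') : Bounded α ι S S' e' :=
  ⟨C.1, C.2.trans h⟩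

/-- The identity circuit. -/
def id (S : List W) : Bounded α ι S S ⟨_, _, 𝟙 (α.obj (den ι S))⟩ :=
  ⟨𝟙 _, by rw [Abstraction.eff, α.map_id]; exact Eff.Le.refl _⟩

/-- The identity circuit on no wires, which has the null effect. -/
def empty : Bounded α ι [] [] (Eff.null E) :=
  ⟨𝟙 _, by
    have h : α.eff (𝟙 (den ι [])) = Eff.null E := by
      have h' : α.obj (den ι []) = unit := α.obj_unit
      rw [Abstraction.eff, α.map_id, h']; rfl
    rw [h]; exact Eff.Le.refl _⟩

/-- `(S ⋊ C); D`, bounded by `(id ⋊ e₁); e₂`. -/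
def seq {S₂ : List W} {t s r : E} {e₁ : t ⟶ s} {e₂ : tensor (α.obj (den ι S)) s ⟶ r}
    (C : Bounded α ι S₁ S₁' ⟨t, s, e₁⟩) (D : Bounded α ι (S ++ S₁') S₂ ⟨_, _, e₂⟩) :
    Bounded α ι (S ++ S₁) S₂ ⟨_, _, wl (α.obj (den ι S)) e₁ ≫ e₂⟩ :=
  ⟨whiskL ι S C.1 ≫ D.1, by
    rw [whiskL, Category.assoc, Category.assoc, Abstraction.eff_eqToHom_comp]
    exact α.le_wl_comp C.2 (by rw [Abstraction.eff_eqToHom_comp]; exact D.2)⟩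

/-- `C; D`, bounded by `α(C); e`. -/
def precomp {s : E} {e : α.obj (den ι S') ⟶ s} (C : Circ ι S S')
    (D : Bounded α ι S' S₁ ⟨_, _, e⟩) : Bounded α ι S S₁ ⟨_, _, α.map C ≫ e⟩ :=
  ⟨C ≫ D.1, α.le_comp C D.2⟩

end Bounded

/-! ## Denotational semantics -/

/-- `♭A`: the parameter part of the interpretation of a type. -/
def Ty.flat (ι : W → M) : Ty W E → Type v
  | .unit => PUnit
  | .nat => ULift ℕ
  | .wire _ => PUnit
  | .tensor A B => A.flat ι × B.flat ι
  | .arrow A B S e => A.flat ι → B.flat ι × Bounded α ι (S ++ A.sharp) B.sharp e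
  | .bang A e => A.flat ι × Bounded α ι [] A.sharp e
  | .circ T U e => Bounded α ι T.wires U.wires e

/-- The graded monad `X ↦ X × {C : S → S' | α(C) ≲ e}`. -/
abbrev CircMonad (ι : W → M) (S S' : List W) (e : Eff E) (X : Type v) : Type v :=
  X × Bounded α ι S S' e

/-- `♭Γ` -/
def Env (ι : W → M) : Ctx W E → Type v
  | [] => PUnit
  | a :: Γ => a.ty.flat α ι × Env ι Γ

variable {α}

def Env.append : ∀ {Γ Δ : Ctx W E}, Env α ι Γ → Env α ι Δ → Env α ι (Γ ++ Δ)
  | [], _, _, σ => σ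
  | _ :: _, _, ρ, σ => (ρ.1, Env.append ρ.2 σ)

def Env.left : ∀ {Γ Δ : Ctx W E}, Env α ι (Γ ++ Δ) → Env α ι Γ
  | [], _, _ => PUnit.unit
  | _ :: _, _, ρ => (ρ.1, Env.left ρ.2)

def Env.right : ∀ {Γ Δ : Ctx W E}, Env α ι (Γ ++ Δ) → Env α ι Δ
  | [], _, ρ => ρ
  | _ :: _, _, ρ => Env.right ρ.2

/-- The environment with exactly one entry. -/
def Env.one {a : Entry W E} (v : a.ty.flat α ι) : Env α ι [a] := (v, PUnit.unit)

/-- The environment of a label context. -/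
def Env.ofLabels : ∀ Q : LCtx W, Env α ι (Q.toCtx : Ctx W E)
  | [] => PUnit.unit
  | _ :: Q => (PUnit.unit, Env.ofLabels Q)

def Env.exchange : ∀ {Γ₁ Γ₂ : Ctx W E} {a b : Entry W E},
    Env α ι (Γ₁ ++ b :: a :: Γ₂) → Env α ι (Γ₁ ++ a :: b :: Γ₂)
  | [], _, _, _, ρ => (ρ.2.1, ρ.1, ρ.2.2)
  | _ :: _, _, _, _, ρ => (ρ.1, Env.exchange ρ.2)

/-- The unique element of `♭T`, for a bundle type `T`. -/
def BTy.point (α : Abstraction M E) (ι : W → M) : ∀ T : BTy W, (T.toTy : Ty W E).flat α ι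
  | .unit => PUnit.unit
  | .wire _ => PUnit.unit
  | .tensor T U => (BTy.point α ι T, BTy.point α ι U)

/-- A value uses its wires exactly as they are: `♯Γ = ♯A`. -/
theorem VTy.sharp_eq : ∀ {Γ : Ctx W E} {V : Val ι E} {A : Ty W E}, VTy α Γ V A → Γ.sharp = A.sharp
  | _, _, _, .unit hΦ _ => hΦ.sharp_eq
  | _, _, _, .nat _ hΦ _ => hΦ.sharp_eq
  | _, _, _, .lab _ _ hΦ _ => by rw [Ctx.sharp_append, hΦ.sharp_eq]; rfl
  | _, _, _, .var _ _ hΦ _ => by rw [Ctx.sharp_append, hΦ.sharp_eq, Ctx.sharp_var]; rfl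
  | _, _, _, .abs _ => rfl
  | _, _, _, .lift hΦ _ => hΦ.sharp_eq
  | _, _, _, .circ _ hΦ _ _ _ _ _ _ _ => hΦ.sharp_eq
  | _, _, _, .pair hΦ _ h h' => by
      have i := VTy.sharp_eq h
      have i' := VTy.sharp_eq h'
      rw [Ctx.sharp_append, hΦ.sharp_eq, List.nil_append] at i i'
      rw [Ctx.sharp_append, Ctx.sharp_append, hΦ.sharp_eq, List.nil_append, i, i']; rfl

mutual
/-- `♭⟦Γ ⊢ V : A⟧`. -/
def VTy.sem : ∀ {Γ : Ctx W E} {V : Val ι E} {A : Ty W E},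
    VTy α Γ V A → Env α ι Γ → A.flat α ι
  | _, _, _, .unit _ _, _ => PUnit.unit
  | _, _, _, .nat n _ _, _ => ULift.up n
  | _, _, _, .lab _ _ _ _, _ => PUnit.unit
  | _, _, _, .var _ _ _ _, ρ => ρ.right.1
  | _, _, _, .abs h, ρ => fun v =>
      let r := h.sem (ρ.append (Env.one v))
      (r.1, r.2.cast (by rw [Ctx.sharp_append, Ctx.sharp_var]) rfl)
  | _, _, _, .lift hΦ h, ρ =>
      let r := h.sem ρ
      (r.1, r.2.cast hΦ.sharp_eq.symm rfl)
  | _, _, _, .circ C _ _ _ _ σ τ hl hk, _ => ⟨boxMor ι σ τ hl hk C, Eff.Le.refl _⟩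
  | _, _, _, .pair _ _ h h', ρ =>
      (h.sem (ρ.left.left.append ρ.left.right), h'.sem (ρ.left.left.append ρ.right))
/-- `⟦Γ ⊢ N : A ; e⟧`. -/
def CTy.sem : ∀ {Γ : Ctx W E} {N : Tm ι E} {A : Ty W E} {e : Eff E},
    CTy α Γ N A e → Env α ι Γ → CircMonad α ι Γ.sharp A.sharp e (A.flat α ι)
  | _, _, _, _, .app hΦ _ h h', ρ =>
      let r := h.sem (ρ.left.left.append ρ.left.right) (h'.sem (ρ.left.left.append ρ.right))
      (r.1, r.2.cast (by
        have i := h.sharp_eq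
        have i' := h'.sharp_eq
        rw [Ctx.sharp_append, hΦ.sharp_eq, List.nil_append] at i i'
        rw [Ctx.sharp_append, Ctx.sharp_append, hΦ.sharp_eq, List.nil_append, i, i']; rfl) rfl)
  | _, _, _, _, .force hΦ h, ρ =>
      let r := h.sem ρ
      (r.1, r.2.cast hΦ.sharp_eq rfl)
  | _, _, _, _, .box (T := T) (U := U) hΦ h, ρ =>
      ((h.sem ρ (BTy.point α ι T)).2.cast (BTy.sharp_toTy T).symm (BTy.sharp_toTy U),
        Bounded.empty.cast hΦ.sharp_eq rfl)
  | _, _, _, _, .apply (T := T) (U := U) hΦ _ h h', ρ =>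
      (BTy.point α ι U, Bounded.cast (h.sem (ρ.left.left.append ρ.left.right)) (by
        have i := h.sharp_eq
        have i' := h'.sharp_eq
        rw [Ctx.sharp_append, hΦ.sharp_eq, List.nil_append] at i i'
        rw [Ctx.sharp_append, Ctx.sharp_append, hΦ.sharp_eq, List.nil_append, i, i',
          BTy.sharp_toTy]; rfl) (BTy.sharp_toTy U).symm)
  | _, _, _, _, .dest hΦ _ h h', ρ =>
      let v := h.sem (ρ.left.left.append ρ.right)
      let r := h'.sem (ρ.left.append ((Env.one v.1).append (Env.one v.2)))
      (r.1, r.2.cast (by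
        have i := h.sharp_eq
        rw [Ctx.sharp_append, hΦ.sharp_eq, List.nil_append] at i
        rw [Ctx.sharp_append, Ctx.sharp_append (_ ++ _), i]
        simp [Ctx.sharp, Entry.ty, Ty.sharp]) rfl)
  | _, _, _, _, .ifz hΦ h h₀ h₁, ρ =>
      match (h.sem ρ.left).down with
      | 0 => h₀.sem ρ
      | _ + 1 => h₁.sem ρ
  | _, _, _, _, .ret h, ρ => (h.sem ρ, (Bounded.id _).cast h.sharp_eq rfl)
  | _, _, _, _, .letin (Γ₁ := Γ₁) (Γ₂ := Γ₂) (A := A) hΦ _ h h', ρ =>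
      let r := h.sem (ρ.left.left.append ρ.right)
      let r' := h'.sem (ρ.left.append (Env.one r.1))
      (r'.1, (Bounded.seq (S := Γ₂.sharp) (S₁ := Γ₁.sharp) (S₁' := A.sharp)
        (r.2.cast (by rw [Ctx.sharp_append, hΦ.sharp_eq, List.nil_append]) rfl)
        (r'.2.cast (by
          rw [Ctx.sharp_append, Ctx.sharp_append, hΦ.sharp_eq, List.nil_append, Ctx.sharp_var])
          rfl)).cast
        (by rw [Ctx.sharp_append, Ctx.sharp_append, hΦ.sharp_eq, List.nil_append]) rfl)
  | _, _, _, _, .sub h hle, ρ =>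
      let r := h.sem ρ
      (r.1, r.2.weaken ⟨hle⟩)
  | _, _, _, _, .ex (Γ₁ := Γ₁) (Γ₂ := Γ₂) (a := a) (b := b) h, ρ =>
      let r := h.sem ρ.exchange
      (r.1, (Bounded.precomp (ProtoQuipper.exchange ι Γ₁.sharp b.ty.sharp a.ty.sharp Γ₂.sharp)
        (r.2.cast (Ctx.sharp_append Γ₁ (a :: b :: Γ₂)).symm rfl)).cast
        (Ctx.sharp_append Γ₁ (b :: a :: Γ₂)) rfl)
end

/-! ## Configurations -/

/-- Derivations of `Q ⊢ (C, N) : A ; Q' ; e`: the circuit is `C : Q → L, Q'`, and the term `N` is typed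
under `L` with effect `e`. -/
structure ConfigTy (α : Abstraction M E) {Q : LCtx W} (C : LCirc ι Q) (N : Tm ι E) (A : Ty W E)
    (Q' : LCtx W) (e : Eff E) where
  L : LCtx W
  cod_eq : C.cod = L ++ Q'
  distinct : LCtx.Distinct (L ++ Q')
  typing : CTy α L.toCtx N A e

/-- Derivations of `Q ⊢ (C, V) : A ; Q'` for a value `V`. -/
structure ValConfigTy (α : Abstraction M E) {Q : LCtx W} (C : LCirc ι Q) (V : Val ι E) (A : Ty W E)
    (Q' : LCtx W) where
  L : LCtx W
  cod_eq : C.cod = L ++ Q'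
  distinct : LCtx.Distinct (L ++ Q')
  typing : VTy α L.toCtx V A

/-- The functor `J`: a function and a circuit form an effectful function. -/
def J (α : Abstraction M E) {S S' : List W} {X Y : Type v} (p : (X → Y) × Circ ι S S') :
    X → CircMonad α ι S S' (α.eff p.2) Y :=
  fun x => (p.1 x, ⟨p.2, Eff.Le.refl _⟩)

/-- The underlying pair of a value and a circuit, without the bound on the circuit. -/
def CircMonad.forget {S S' : List W} {e : Eff E} {X : Type v} (r : CircMonad α ι S S' e X) :
    X × Circ ι S S' :=
  (r.1, r.2.1)

/-- `⟦(C, N)⟧ = J(id, C); (⟦N⟧ ⋉ Q')`, as a pair of an element of `♭A` and a circuit. -/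
def ConfigTy.sem {Q Q' : LCtx W} {C : LCirc ι Q} {N : Tm ι E} {A : Ty W E} {e : Eff E}
    (h : ConfigTy α C N A Q' e) : PUnit.{v + 1} → A.flat α ι × Circ ι Q.wires (A.sharp ++ Q'.wires) :=
  fun _ =>
    let r := h.typing.sem (Env.ofLabels h.L)
    (r.1, C.hom ≫ idc ι ((congrArg LCtx.wires h.cod_eq).trans (List.map_append ..)) ≫
      whiskR ι (idc ι h.L.sharp_toCtx.symm ≫ r.2.1) Q'.wires)

/-- `⟦(C, V)⟧ = (id, C); (⟦V⟧ ⋉ Q')`, a pair of a function and a circuit; the circuit component of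
`⟦V⟧` is the identity `♯Γ = ♯A`. -/
def ValConfigTy.sem {Q Q' : LCtx W} {C : LCirc ι Q} {V : Val ι E} {A : Ty W E}
    (h : ValConfigTy α C V A Q') :
    (PUnit.{v + 1} → A.flat α ι) × Circ ι Q.wires (A.sharp ++ Q'.wires) :=
  (fun _ => h.typing.sem (Env.ofLabels h.L),
    C.hom ≫ idc ι ((congrArg LCtx.wires h.cod_eq).trans (List.map_append ..)) ≫
      whiskR ι (idc ι (h.L.sharp_toCtx.symm.trans h.typing.sharp_eq)) Q'.wires)

end Effects
end ProtoQuipper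

open ProtoQuipper

-- The proof is a logical-relations (computability) argument. By recursion on types, `VRel A`
-- relates closed values, together with the list of labels they use, to elements of `♭A`. At arrow
-- types it demands that related arguments give applications that compute the denoted result. The
-- recursion on types makes the negative occurrence harmless, and since the language has no
-- recursion, no approximation is needed.
--
-- For terms, `Computes` says that `N`, using the labels `Q`, evaluates on every circuit `C` whose
-- outputs can be permuted into `Q ++ R`. The remaining labels `R` are a frame that `N` leaves
-- alone: up to a permutation of outputs the new circuit is `C; (F ⋉ R)`, where `F` is the circuit
-- denoted by `N`. Quantifying over the frame and over the order of the outputs is what makes the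
-- notion compose. In a `let`, the wires waiting for the continuation join the frame of the first
-- term. Moving them aside and back turns `F ⋉ S` into `S ⋊ F`, by naturality of the symmetry alone
-- (`swapc_whiskR_swapc`), so the interchange law never enters.
--
-- The fundamental property (`VTy.rel`, `CTy.computes`) states that typed values and terms, closed
-- by related values, are related to their interpretations. It goes by induction on derivations; the
-- substantial cases are `Computes.letin`, `Computes.apply`, `Computes.box` and `Computes.precomp`
-- (exchange).
--
-- At unit type with nothing left over the relation is rigid: the result is `*`, the final circuit
-- has no outputs, so its permutation is trivial, and it equals `C; F` (`ConfigTy.adequate`). The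
-- bound `α(F) ≲ e` is part of the interpretation. Applied to `V`, the same property shows that `V`
-- is `*` (`ValConfigTy.of_unit`). The equality of denotations then identifies `C; F` with `D`.

namespace ProtoQuipper
open StrictSymPremonoidal

-- Strict premonoidal categories: heterogeneous equations and coherence of the symmetry.

section Laws

variable {M : Type u} [Category.{v} M]

/-- Strictness consists of equalities of objects, so coherence laws compare morphisms with different
endpoints. They are proved as heterogeneous equalities, in which the transports `eqToHom` disappear;
this congruence and its companions below do the bookkeeping. -/
theorem comp_heq_comp {X Y Z X' Y' Z' : M} {f : X ⟶ Y} {g : Y ⟶ Z} {f' : X' ⟶ Y'} {g' : Y' ⟶ Z'}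
    (hX : X = X') (hY : Y = Y') (hZ : Z = Z') (hf : f ≍ f') (hg : g ≍ g') :
    f ≫ g ≍ f' ≫ g' := by
  subst hX hY hZ; cases hf; cases hg; rfl

theorem eqToHom_comp_heq_self {X Y Z : M} (h : X = Y) (f : Y ⟶ Z) : eqToHom h ≫ f ≍ f := by
  subst h; simp

theorem comp_eqToHom_heq_self {X Y Z : M} (f : X ⟶ Y) (h : Y = Z) : f ≫ eqToHom h ≍ f := by
  subst h; simp

theorem conj_eqToHom_heq_self {X Y Z T : M} (h : X = Y) (f : Y ⟶ Z) (h' : Z = T) :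
    eqToHom h ≫ f ≫ eqToHom h' ≍ f := by
  subst h h'; simp

theorem eqToHom_heq_eqToHom {X Y X' Y' : M} (h : X = Y) (h' : X' = Y') (hX : X = X') :
    eqToHom h ≍ eqToHom h' := by
  subst h h' hX; rfl

variable [StrictSymPremonoidal M]

theorem wl_heq {X X' Y Y' Z Z' : M} {f : Y ⟶ Z} {f' : Y' ⟶ Z'} (hX : X = X') (hY : Y = Y')
    (hZ : Z = Z') (h : f ≍ f') : wl X f ≍ wl X' f' := by
  subst hX hY hZ; cases h; rfl

theorem wr_heq {X X' Y Y' Z Z' : M} {f : Y ⟶ Z} {f' : Y' ⟶ Z'} (hX : X = X') (hY : Y = Y')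
    (hZ : Z = Z') (h : f ≍ f') : wr f X ≍ wr f' X' := by
  subst hX hY hZ; cases h; rfl

theorem braid_heq {X X' Y Y' : M} (hX : X = X') (hY : Y = Y') : braid X Y ≍ braid X' Y' := by
  subst hX hY; rfl

/-- The hexagon `braid_tensor` at `unit ⊗ unit = unit` makes the symmetry with the unit idempotent.
It is also invertible, and an invertible idempotent is an identity. -/
theorem braid_unit_right (X : M) : braid X unit = eqToHom ((tensor_unit X).trans (unit_tensor X).symm) := by
  set b : X ⟶ X := eqToHom (tensor_unit X).symm ≫ braid X unit ≫ eqToHom (unit_tensor X) with hb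
  have hbb : b ≍ braid X unit := conj_eqToHom_heq_self _ _ _
  have h₁ : b = b ≫ b := by
    apply eq_of_heq
    refine hbb.trans ((braid_heq rfl (unit_tensor unit).symm).trans ?_)
    rw [braid_tensor]
    refine (eqToHom_comp_heq_self _ _).trans ?_
    refine comp_heq_comp ((tensor_unit _).trans (tensor_unit _))
      ((tensor_unit _).trans (unit_tensor _)) ?_ ((wr_unit _).trans hbb.symm) ?_
    · simp only [tensor_unit, unit_tensor]
    · refine (eqToHom_comp_heq_self _ _).trans ((comp_eqToHom_heq_self _ _).trans ?_)
      exact (wl_unit _).trans hbb.symm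
  have h₂ : b ≫ (eqToHom (unit_tensor X).symm ≫ braid unit X ≫ eqToHom (tensor_unit X)) = 𝟙 X := by
    simp only [hb, Category.assoc, eqToHom_trans_assoc, eqToHom_refl, Category.id_comp]
    rw [← Category.assoc (braid X unit), braid_braid]
    simp
  have h₃ : b = 𝟙 X := by
    have := congrArg (· ≫ (eqToHom (unit_tensor X).symm ≫ braid unit X ≫ eqToHom (tensor_unit X))) h₁
    simp only [Category.assoc, h₂] at this
    rw [this, Category.comp_id]
  have h₄ : braid X unit = eqToHom (tensor_unit X) ≫ b ≫ eqToHom (unit_tensor X).symm := by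
    simp [hb]
  rw [h₄, h₃]
  simp

theorem braid_unit_left (X : M) : braid unit X = eqToHom ((unit_tensor X).trans (tensor_unit X).symm) := by
  have h := braid_braid X unit
  rw [braid_unit_right] at h
  calc braid unit X = eqToHom ((unit_tensor X).trans (tensor_unit X).symm) ≫
        eqToHom ((tensor_unit X).trans (unit_tensor X).symm) ≫ braid unit X := by simp
    _ = _ := by rw [h, Category.comp_id]

/-- The right-hand side is a left inverse of `braid Z (tensor X Y)`, by the other hexagon and
cancellation of symmetries in pairs. Such an inverse must be `braid (tensor X Y) Z`. -/
theorem braid_tensor_left (X Y Z : M) :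
    braid (tensor X Y) Z =
      eqToHom (tensor_assoc X Y Z) ≫ wl X (braid Y Z) ≫ eqToHom (tensor_assoc X Z Y).symm ≫
        wr (braid X Z) Y ≫ eqToHom (tensor_assoc Z X Y) := by
  set g := eqToHom (tensor_assoc X Y Z) ≫ wl X (braid Y Z) ≫ eqToHom (tensor_assoc X Z Y).symm ≫
        wr (braid X Z) Y ≫ eqToHom (tensor_assoc Z X Y) with hg
  have h : g ≫ braid Z (tensor X Y) = 𝟙 _ := by
    rw [braid_tensor, hg]
    simp only [Category.assoc, eqToHom_trans_assoc, eqToHom_refl, Category.id_comp]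
    rw [← Category.assoc (wr _ _), ← wr_comp, braid_braid, wr_id]
    simp only [Category.id_comp, eqToHom_trans_assoc, eqToHom_refl]
    rw [← Category.assoc (wl _ _), ← wl_comp, braid_braid, wl_id]
    simp
  calc braid (tensor X Y) Z = (g ≫ braid Z (tensor X Y)) ≫ braid (tensor X Y) Z := by
        rw [h, Category.id_comp]
    _ = g := by rw [Category.assoc, braid_braid, Category.comp_id]

end Laws

-- Whiskerings and symmetries on lists of wires.

section CircuitLaws

variable {M : Type u} [Category.{v} M] [StrictSymPremonoidal M] {W : Type w} {ι : W → M}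

@[simp]
theorem idc_rfl (S : List W) : idc ι (rfl : S = S) = 𝟙 _ := rfl

@[simp]
theorem idc_comp_idc {S S' S'' : List W} (h : S = S') (h' : S' = S'') :
    idc ι h ≫ idc ι h' = idc ι (h.trans h') := by
  simp [idc]

@[simp]
theorem idc_comp_idc_assoc {S S' S'' S₁ : List W} (h : S = S') (h' : S' = S'') (F : Circ ι S'' S₁) :
    idc ι h ≫ idc ι h' ≫ F = idc ι (h.trans h') ≫ F := by
  simp [idc]

theorem conj_idc_heq {S S' S₁ S₁' : List W} (h : S = S') (F : Circ ι S' S₁) (h' : S₁ = S₁') :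
    idc ι h ≫ F ≫ idc ι h' ≍ F :=
  conj_eqToHom_heq_self _ _ _

/-- The way back from heterogeneous equality to an honest equation of circuits, with the transports
made explicit. -/
theorem eq_conj_idc_of_heq {S S' S₁ S₁' : List W} {F : Circ ι S S₁'} {G : Circ ι S' S₁}
    (h : S = S') (h' : S₁ = S₁') (H : F ≍ G) : F = idc ι h ≫ G ≫ idc ι h' := by
  subst h h'; cases H; simp

theorem whiskL_heq_wl (S : List W) {S₁ S₂ : List W} (F : Circ ι S₁ S₂) :
    whiskL ι S F ≍ wl (den ι S) F :=
  conj_eqToHom_heq_self _ _ _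

theorem whiskR_heq_wr {S₁ S₂ : List W} (F : Circ ι S₁ S₂) (S : List W) :
    whiskR ι F S ≍ wr F (den ι S) :=
  conj_eqToHom_heq_self _ _ _

theorem swapc_heq_braid (S S' : List W) : swapc ι S S' ≍ braid (den ι S) (den ι S') :=
  conj_eqToHom_heq_self _ _ _

theorem whiskL_congr_heq {S S₁ S₂ S' S₁' S₂' : List W} {F : Circ ι S₁ S₂} {F' : Circ ι S₁' S₂'}
    (h : S = S') (h₁ : S₁ = S₁') (h₂ : S₂ = S₂') (H : F ≍ F') : whiskL ι S F ≍ whiskL ι S' F' := by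
  subst h h₁ h₂; cases H; rfl

theorem whiskR_congr_heq {S S₁ S₂ S' S₁' S₂' : List W} {F : Circ ι S₁ S₂} {F' : Circ ι S₁' S₂'}
    (h : S = S') (h₁ : S₁ = S₁') (h₂ : S₂ = S₂') (H : F ≍ F') : whiskR ι F S ≍ whiskR ι F' S' := by
  subst h h₁ h₂; cases H; rfl

theorem whiskR_comp {S₁ S₂ S₃ : List W} (F : Circ ι S₁ S₂) (G : Circ ι S₂ S₃) (S : List W) :
    whiskR ι (F ≫ G : Circ ι S₁ S₃) S = whiskR ι F S ≫ whiskR ι G S := by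
  simp [whiskR, wr_comp]

theorem whiskR_idc {S₁ S₂ : List W} (h : S₁ = S₂) (S : List W) :
    whiskR ι (idc ι h) S = idc ι (congrArg (· ++ S) h) := by
  subst h; simp [whiskR, wr_id]

theorem whiskR_id (S S' : List W) : whiskR ι (𝟙 _ : Circ ι S S) S' = 𝟙 _ :=
  whiskR_idc rfl S'

theorem whiskR_nil {S₁ S₂ : List W} (F : Circ ι S₁ S₂) :
    whiskR ι F [] = idc ι (List.append_nil S₁) ≫ F ≫ idc ι (List.append_nil S₂).symm :=
  eq_conj_idc_of_heq _ _ ((whiskR_heq_wr F []).trans (wr_unit F))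

theorem whiskR_append {S₁ S₂ : List W} (F : Circ ι S₁ S₂) (S S' : List W) :
    whiskR ι F (S ++ S') = idc ι (List.append_assoc S₁ S S').symm ≫ whiskR ι (whiskR ι F S) S' ≫
      idc ι (List.append_assoc S₂ S S') := by
  apply eq_conj_idc_of_heq
  refine (whiskR_heq_wr _ _).trans ((wr_heq (den_append ι S S') rfl rfl HEq.rfl).trans ?_)
  refine (wr_tensor F _ _).trans (HEq.trans ?_ (whiskR_heq_wr _ _).symm)
  exact wr_heq rfl (den_append ι _ _).symm (den_append ι _ _).symm (whiskR_heq_wr _ _).symm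

theorem swapc_swapc (S S' : List W) : swapc ι S S' ≫ swapc ι S' S = 𝟙 _ := by
  simp only [swapc, Category.assoc, eqToHom_trans_assoc, eqToHom_refl, Category.id_comp]
  rw [← Category.assoc (braid _ _), braid_braid]
  simp

theorem swapc_natural {S₁ S₂ : List W} (F : Circ ι S₁ S₂) (S : List W) :
    whiskR ι F S ≫ swapc ι S₂ S = swapc ι S₁ S ≫ whiskL ι S F := by
  simp only [swapc, whiskR, whiskL, Category.assoc, eqToHom_trans_assoc, eqToHom_refl,
    Category.id_comp]
  rw [← Category.assoc (wr _ _), braid_natural]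
  simp

/-- Acting on the second group of wires by exchanging it with the first, and back. -/
theorem swapc_whiskR_swapc {S₁ S₁' : List W} (F : Circ ι S₁ S₁') (S : List W) :
    swapc ι S S₁ ≫ whiskR ι F S ≫ swapc ι S₁' S = whiskL ι S F := by
  rw [swapc_natural, ← Category.assoc, swapc_swapc, Category.id_comp]

end CircuitLaws

-- Permutations of label contexts and the circuits that they denote.

section Permutations

variable {M : Type u} [Category.{v} M] [StrictSymPremonoidal M] {W : Type w} {ι : W → M}

theorem LCtx.wires_append (Q R : LCtx W) : LCtx.wires (Q ++ R) = Q.wires ++ R.wires :=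
  List.map_append ..

namespace LPerm

theorem perm {Q Q' : LCtx W} (π : LPerm Q Q') : Q.Perm Q' := by
  induction π with
  | nil => exact .nil
  | cons a _ ih => exact .cons a ih
  | swap a b Q => exact .swap b a Q
  | trans _ _ ih ih' => exact ih.trans ih'

theorem distinct_iff {Q Q' : LCtx W} (π : LPerm Q Q') : Q.Distinct ↔ Q'.Distinct :=
  (π.perm.map Prod.fst).nodup_iff

def refl : ∀ Q : LCtx W, LPerm Q Q
  | [] => .nil
  | a :: Q => .cons a (refl Q)

def ofEq {Q Q' : LCtx W} (h : Q = Q') : LPerm Q Q' := h ▸ refl Q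

def appendRight : ∀ {Q Q' : LCtx W}, LPerm Q Q' → ∀ R : LCtx W, LPerm (Q ++ R) (Q' ++ R)
  | _, _, .nil, R => refl R
  | _, _, .cons a σ, R => .cons a (appendRight σ R)
  | _, _, .swap a b Q, R => .swap a b (Q ++ R)
  | _, _, .trans σ τ, R => .trans (appendRight σ R) (appendRight τ R)

def appendLeft : ∀ (P : LCtx W) {Q Q' : LCtx W}, LPerm Q Q' → LPerm (P ++ Q) (P ++ Q')
  | [], _, _, σ => σ
  | a :: P, _, _, σ => .cons a (appendLeft P σ)

/-- Moving the first label past a list of labels. -/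
def moveRight (a : ℕ × W) : ∀ B : LCtx W, LPerm (a :: B) (B ++ [a])
  | [] => refl [a]
  | b :: B => .trans (.swap a b B) (.cons b (moveRight a B))

/-- Exchanging two neighbouring lists of labels. -/
def swapBlocks : ∀ A B : LCtx W, LPerm (A ++ B) (B ++ A)
  | [], B => ofEq (List.append_nil B).symm
  | a :: A, B => .trans (.cons a (swapBlocks A B))
      (.trans ((moveRight a B).appendRight A) (ofEq (List.append_assoc B [a] A)))

theorem circ_refl : ∀ Q : LCtx W, (refl Q).circ ι = 𝟙 _
  | [] => rfl
  | a :: Q => by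
      change wl (ι a.2) ((refl Q).circ ι) = _
      rw [circ_refl Q, wl_id]; rfl

theorem circ_ofEq {Q Q' : LCtx W} (h : Q = Q') :
    (ofEq h).circ ι = idc ι (congrArg LCtx.wires h) := by
  subst h; exact circ_refl Q

theorem den_wires_append (Q R : LCtx W) :
    den ι (LCtx.wires (Q ++ R)) = tensor (den ι Q.wires) (den ι R.wires) := by
  rw [LCtx.wires_append, den_append]

/-- Right whiskering passes through every constructor: it commutes with left whiskering (`wr_wl`)
under `cons`, merges with the whiskering of the swapped pair (`wr_tensor`), and is functorial for
`trans`. -/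
theorem circ_appendRight_heq_wr : ∀ {Q Q' : LCtx W} (π : LPerm Q Q') (R : LCtx W),
    (π.appendRight R).circ ι ≍ wr (π.circ ι) (den ι R.wires)
  | _, _, .nil, R => by
      change (refl R).circ ι ≍ wr (𝟙 (den ι [])) (den ι R.wires)
      rw [circ_refl, wr_id]
      exact (congr_arg_heq 𝟙 (unit_tensor _)).symm
  | _, _, .cons a (Q := Q) (Q' := Q') σ, R => by
      change wl (ι a.2) ((σ.appendRight R).circ ι) ≍ wr (wl (ι a.2) (σ.circ ι)) (den ι R.wires)
      refine HEq.trans ?_ (wr_wl _ _ _).symm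
      exact wl_heq rfl (den_wires_append Q R) (den_wires_append Q' R) (circ_appendRight_heq_wr σ R)
  | _, _, .swap a b Q, R => by
      change eqToHom _ ≫ wr (braid (ι a.2) (ι b.2)) (den ι (LCtx.wires (Q ++ R))) ≫ eqToHom _ ≍
        wr (eqToHom _ ≫ wr (braid (ι a.2) (ι b.2)) (den ι Q.wires) ≫ eqToHom _) (den ι R.wires)
      refine (conj_eqToHom_heq_self _ _ _).trans ?_
      refine (wr_heq (den_wires_append Q R) rfl rfl HEq.rfl).trans ((wr_tensor _ _ _).trans ?_)
      exact (wr_heq rfl (tensor_assoc _ _ _).symm (tensor_assoc _ _ _).symm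
        (conj_eqToHom_heq_self _ _ _)).symm
  | _, _, .trans (Q := Q) (Q' := Q') (Q'' := Q'') σ τ, R => by
      change (σ.appendRight R).circ ι ≫ (τ.appendRight R).circ ι ≍
        wr (σ.circ ι ≫ τ.circ ι) (den ι R.wires)
      rw [wr_comp]
      exact comp_heq_comp (den_wires_append Q R) (den_wires_append Q' R) (den_wires_append Q'' R)
        (circ_appendRight_heq_wr σ R) (circ_appendRight_heq_wr τ R)

theorem circ_appendRight {Q Q' : LCtx W} (π : LPerm Q Q') (R : LCtx W) :
    (π.appendRight R).circ ι = idc ι (LCtx.wires_append Q R) ≫ whiskR ι (π.circ ι) R.wires ≫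
      idc ι (LCtx.wires_append Q' R).symm :=
  eq_conj_idc_of_heq _ _ ((circ_appendRight_heq_wr π R).trans (whiskR_heq_wr _ _).symm)

theorem circ_appendLeft_heq_wl : ∀ (P : LCtx W) {Q Q' : LCtx W} (π : LPerm Q Q'),
    (appendLeft P π).circ ι ≍ wl (den ι P.wires) (π.circ ι)
  | [], _, _, π => (wl_unit _).symm
  | a :: P, Q, Q', π => by
      change wl (ι a.2) ((appendLeft P π).circ ι) ≍
        wl (tensor (ι a.2) (den ι (LCtx.wires P))) (π.circ ι)
      refine HEq.trans ?_ (wl_tensor _ _ _).symm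
      exact wl_heq rfl (den_wires_append P Q) (den_wires_append P Q') (circ_appendLeft_heq_wl P π)

theorem circ_appendLeft (P : LCtx W) {Q Q' : LCtx W} (π : LPerm Q Q') :
    (appendLeft P π).circ ι = idc ι (LCtx.wires_append P Q) ≫ whiskL ι P.wires (π.circ ι) ≫
      idc ι (LCtx.wires_append P Q').symm :=
  eq_conj_idc_of_heq _ _ ((circ_appendLeft_heq_wl P π).trans (whiskL_heq_wl _ _).symm)

theorem den_wires_concat (a : ℕ × W) (B : LCtx W) :
    den ι (LCtx.wires (B ++ [a])) = tensor (den ι B.wires) (ι a.2) := by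
  rw [den_wires_append]
  exact congrArg (tensor (den ι B.wires)) (tensor_unit (ι a.2))

/-- The recursion defining `moveRight` is the hexagon `braid_tensor`, and its base case is the
symmetry with the unit. -/
theorem circ_moveRight_heq (a : ℕ × W) : ∀ B : LCtx W,
    (moveRight a B).circ ι ≍ braid (ι a.2) (den ι B.wires)
  | [] => by
      change (refl [a]).circ ι ≍ braid (ι a.2) unit
      rw [circ_refl, braid_unit_right]
      exact eqToHom_heq_eqToHom (rfl : den ι [a.2] = den ι [a.2]) _ rfl
  | b :: B => by
      change (eqToHom _ ≫ wr (braid (ι a.2) (ι b.2)) (den ι (LCtx.wires B)) ≫ eqToHom _) ≫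
          wl (ι b.2) ((moveRight a B).circ ι) ≍ braid (ι a.2) (tensor (ι b.2) (den ι (LCtx.wires B)))
      rw [braid_tensor]
      simp only [Category.assoc]
      refine (eqToHom_comp_heq_self _ _).trans
        (HEq.trans ?_ (eqToHom_comp_heq_self _ _).symm)
      refine comp_heq_comp rfl rfl ?_ HEq.rfl ?_
      · change tensor (ι b.2) (den ι (LCtx.wires (B ++ [a]))) = _
        rw [den_wires_concat, tensor_assoc]
      · refine comp_heq_comp rfl rfl ?_ HEq.rfl ?_
        · change tensor (ι b.2) (den ι (LCtx.wires (B ++ [a]))) = _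
          rw [den_wires_concat, tensor_assoc]
        · refine HEq.trans ?_ (comp_eqToHom_heq_self _ _).symm
          exact wl_heq rfl rfl (den_wires_concat a B) (circ_moveRight_heq a B)

/-- The recursion defining `swapBlocks` is the hexagon in the first argument, `braid_tensor_left`,
with `circ_moveRight_heq` for the label that is moved. -/
theorem circ_swapBlocks_heq : ∀ A B : LCtx W,
    (swapBlocks A B).circ ι ≍ braid (den ι A.wires) (den ι B.wires)
  | [], B => by
      change (ofEq (List.append_nil B).symm).circ ι ≍ braid unit (den ι B.wires)
      rw [circ_ofEq, braid_unit_left]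
      exact eqToHom_heq_eqToHom _ _ (unit_tensor _).symm
  | a :: A, B => by
      change wl (ι a.2) ((swapBlocks A B).circ ι) ≫ ((moveRight a B).appendRight A).circ ι ≫
          (ofEq (List.append_assoc B [a] A)).circ ι ≍
        braid (tensor (ι a.2) (den ι (LCtx.wires A))) (den ι B.wires)
      rw [braid_tensor_left, circ_ofEq]
      refine HEq.trans ?_ (eqToHom_comp_heq_self _ _).symm
      refine comp_heq_comp (congrArg _ (den_wires_append A B)) (congrArg _ (den_wires_append B A)) ?_
        (wl_heq rfl (den_wires_append A B) (den_wires_append B A) (circ_swapBlocks_heq A B)) ?_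
      · exact den_wires_append B (a :: A)
      · refine (comp_eqToHom_heq_self _ _).trans (HEq.trans ?_ (eqToHom_comp_heq_self _ _).symm)
        refine HEq.trans ?_ (comp_eqToHom_heq_self _ _).symm
        exact (circ_appendRight_heq_wr _ _).trans
          (wr_heq rfl rfl (den_wires_concat a B) (circ_moveRight_heq a B))

theorem circ_swapBlocks (A B : LCtx W) :
    (swapBlocks A B).circ ι = idc ι (LCtx.wires_append A B) ≫ swapc ι A.wires B.wires ≫
      idc ι (LCtx.wires_append B A).symm :=
  eq_conj_idc_of_heq _ _ ((circ_swapBlocks_heq A B).trans (swapc_heq_braid _ _).symm)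

/-- A permutation is a derivation, and different derivations are not shown to denote the same
circuit. Only this instance of coherence is needed: from the empty context every intermediate
context is empty. Emptiness is a separate hypothesis so that induction on the derivation applies. -/
theorem circ_of_eq_nil {Q Q' : LCtx W} (π : LPerm Q Q') (h : Q = []) :
    ∃ h' : Q = Q', π.circ ι = idc ι (congrArg LCtx.wires h') := by
  induction π with
  | nil => exact ⟨rfl, rfl⟩
  | cons a _ ih => cases h
  | swap a b Q => cases h
  | trans σ τ ih ih' =>
      obtain ⟨h₁, e₁⟩ := ih h
      subst h₁
      obtain ⟨h₂, e₂⟩ := ih' h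
      subst h₂
      exact ⟨rfl, by simp [LPerm.circ, e₁, e₂]⟩

end LPerm

/-- The exchange of two neighbouring groups of labels in a label context. -/
theorem exists_lperm_exchange (Q₁ P P' Q₂ : LCtx W) :
    ∃ π : LPerm (Q₁ ++ (P ++ (P' ++ Q₂))) (Q₁ ++ (P' ++ (P ++ Q₂))),
      π.circ ι ≍ exchange ι Q₁.wires P.wires P'.wires Q₂.wires := by
  refine ⟨.appendLeft Q₁ (.trans (.ofEq (List.append_assoc P P' Q₂).symm)
    (.trans ((LPerm.swapBlocks P P').appendRight Q₂) (.ofEq (List.append_assoc P' P Q₂)))), ?_⟩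
  rw [LPerm.circ_appendLeft]
  refine (conj_idc_heq _ _ _).trans (whiskL_congr_heq rfl ?_ ?_ ?_)
  · simp only [LCtx.wires_append]
  · simp only [LCtx.wires_append]
  · rw [LPerm.circ, LPerm.circ, LPerm.circ_ofEq, LPerm.circ_ofEq, LPerm.circ_appendRight]
    refine (conj_idc_heq _ _ _).trans ((conj_idc_heq _ _ _).trans ?_)
    refine HEq.trans ?_ (conj_idc_heq _ _ _).symm
    refine whiskR_congr_heq rfl (LCtx.wires_append _ _) (LCtx.wires_append _ _) ?_
    rw [LPerm.circ_swapBlocks]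
    exact conj_idc_heq _ _ _

end Permutations

-- Free variables and closing substitutions.

section Substitution

variable {M : Type u} [Category.{v} M] [StrictSymPremonoidal M] {W : Type w} {ι : W → M}
  {E : Type u'} [Category.{v'} E]

mutual
/-- The variable `x` occurs free in a value. -/
def Val.Free (x : ℕ) : Val ι E → Prop
  | .unit => False
  | .nat _ => False
  | .lab _ => False
  | .var y => y = x
  | .abs y _ N => y ≠ x ∧ Tm.Free x N
  | .lift N => Tm.Free x N
  | .boxed _ _ _ _ _ => False
  | .pair V₁ V₂ => Val.Free x V₁ ∨ Val.Free x V₂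
/-- The variable `x` occurs free in a term. -/
def Tm.Free (x : ℕ) : Tm ι E → Prop
  | .app V V' => Val.Free x V ∨ Val.Free x V'
  | .dest y z V N => Val.Free x V ∨ y ≠ x ∧ z ≠ x ∧ Tm.Free x N
  | .force V => Val.Free x V
  | .box _ V => Val.Free x V
  | .apply V V' => Val.Free x V ∨ Val.Free x V'
  | .ifz V N N' => Val.Free x V ∨ Tm.Free x N ∨ Tm.Free x N'
  | .ret V => Val.Free x V
  | .letin y N N' => Tm.Free x N ∨ y ≠ x ∧ Tm.Free x N'
end

/-- A value without free variables. -/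
def Val.Closed (V : Val ι E) : Prop := ∀ x, ¬ V.Free x

mutual
theorem Val.subst_of_not_free {x : ℕ} (X : Val ι E) :
    ∀ {V : Val ι E}, ¬ V.Free x → Val.subst x X V = V
  | .unit, _ => rfl
  | .nat _, _ => rfl
  | .lab _, _ => rfl
  | .var y, h => by simp_all [Val.Free, Val.subst]
  | .abs y _ N, h => by
      by_cases hy : y = x
      · simp [Val.subst, hy]
      · have h' : ¬ N.Free x := fun hN => h ⟨hy, hN⟩
        simp [Val.subst, hy, Tm.subst_of_not_free X h']
  | .lift N, h => by
      have h' : ¬ N.Free x := h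
      simp [Val.subst, Tm.subst_of_not_free X h']
  | .boxed _ _ _ _ _, _ => rfl
  | .pair V V', h => by
      obtain ⟨h₁, h₂⟩ := not_or.1 (show ¬ (V.Free x ∨ V'.Free x) from h)
      simp [Val.subst, Val.subst_of_not_free X h₁, Val.subst_of_not_free X h₂]
theorem Tm.subst_of_not_free {x : ℕ} (X : Val ι E) :
    ∀ {N : Tm ι E}, ¬ N.Free x → N.subst x X = N
  | .app V V', h => by
      obtain ⟨h₁, h₂⟩ := not_or.1 (show ¬ (V.Free x ∨ V'.Free x) from h)
      simp [Tm.subst, Val.subst_of_not_free X h₁, Val.subst_of_not_free X h₂]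
  | .dest y z V N, h => by
      obtain ⟨h₁, h₂⟩ := not_or.1 (show ¬ (V.Free x ∨ y ≠ x ∧ z ≠ x ∧ N.Free x) from h)
      by_cases hy : y = x ∨ z = x
      · simp [Tm.subst, Val.subst_of_not_free X h₁, hy]
      · have h' : ¬ N.Free x := fun hN => h₂ ⟨fun e => hy (.inl e), fun e => hy (.inr e), hN⟩
        simp [Tm.subst, Val.subst_of_not_free X h₁, Tm.subst_of_not_free X h']
  | .force V, h => by
      have h' : ¬ V.Free x := h
      simp [Tm.subst, Val.subst_of_not_free X h']
  | .box _ V, h => by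
      have h' : ¬ V.Free x := h
      simp [Tm.subst, Val.subst_of_not_free X h']
  | .apply V V', h => by
      obtain ⟨h₁, h₂⟩ := not_or.1 (show ¬ (V.Free x ∨ V'.Free x) from h)
      simp [Tm.subst, Val.subst_of_not_free X h₁, Val.subst_of_not_free X h₂]
  | .ifz V N N', h => by
      obtain ⟨h₁, h₂⟩ := not_or.1 (show ¬ (V.Free x ∨ N.Free x ∨ N'.Free x) from h)
      obtain ⟨h₂, h₃⟩ := not_or.1 h₂
      simp [Tm.subst, Val.subst_of_not_free X h₁, Tm.subst_of_not_free X h₂,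
        Tm.subst_of_not_free X h₃]
  | .ret V, h => by
      have h' : ¬ V.Free x := h
      simp [Tm.subst, Val.subst_of_not_free X h']
  | .letin y N N', h => by
      obtain ⟨h₁, h₂⟩ := not_or.1 (show ¬ (N.Free x ∨ y ≠ x ∧ N'.Free x) from h)
      by_cases hy : y = x
      · simp [Tm.subst, Tm.subst_of_not_free X h₁, hy]
      · have h' : ¬ N'.Free x := fun hN => h₂ ⟨hy, hN⟩
        simp [Tm.subst, Tm.subst_of_not_free X h₁, Tm.subst_of_not_free X h']
end

theorem Val.Closed.subst_eq {V : Val ι E} (h : V.Closed) (x : ℕ) (X : Val ι E) : Val.subst x X V = V :=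
  Val.subst_of_not_free X (h x)

mutual
theorem Val.Free.of_subst {x y : ℕ} {X : Val ι E} (hX : X.Closed) :
    ∀ {V : Val ι E}, (Val.subst x X V).Free y → V.Free y ∧ x ≠ y
  | .unit, h => h.elim
  | .nat _, h => h.elim
  | .lab _, h => h.elim
  | .var z, h => by
      by_cases hz : z = x
      · simp only [Val.subst, hz, if_true] at h
        exact (hX y h).elim
      · simp only [Val.subst, hz, if_false] at h
        exact ⟨h, fun e => hz (Eq.trans h e.symm)⟩
  | .abs z _ N, h => by
      by_cases hz : z = x
      · simp only [Val.subst, hz, if_true] at h ⊢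
        exact ⟨h, h.1⟩
      · simp only [Val.subst, hz, if_false] at h
        exact ⟨⟨h.1, (Tm.Free.of_subst hX h.2).1⟩, (Tm.Free.of_subst hX h.2).2⟩
  | .lift N, h => Tm.Free.of_subst (N := N) hX h
  | .boxed _ _ _ _ _, h => h.elim
  | .pair V V', h => by
      rcases h with h | h
      · exact ⟨.inl (Val.Free.of_subst hX h).1, (Val.Free.of_subst hX h).2⟩
      · exact ⟨.inr (Val.Free.of_subst hX h).1, (Val.Free.of_subst hX h).2⟩
theorem Tm.Free.of_subst {x y : ℕ} {X : Val ι E} (hX : X.Closed) :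
    ∀ {N : Tm ι E}, (N.subst x X).Free y → N.Free y ∧ x ≠ y
  | .app V V', h => by
      rcases h with h | h
      · exact ⟨.inl (Val.Free.of_subst hX h).1, (Val.Free.of_subst hX h).2⟩
      · exact ⟨.inr (Val.Free.of_subst hX h).1, (Val.Free.of_subst hX h).2⟩
  | .dest z z' V N, h => by
      rcases h with h | ⟨h₁, h₂, h⟩
      · exact ⟨.inl (Val.Free.of_subst hX h).1, (Val.Free.of_subst hX h).2⟩
      · by_cases hz : z = x ∨ z' = x
        · simp only [hz, if_true] at h
          refine ⟨.inr ⟨h₁, h₂, h⟩, ?_⟩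
          rcases hz with hz | hz
          · exact hz ▸ h₁
          · exact hz ▸ h₂
        · simp only [hz, if_false] at h
          exact ⟨.inr ⟨h₁, h₂, (Tm.Free.of_subst hX h).1⟩, (Tm.Free.of_subst hX h).2⟩
  | .force V, h => Val.Free.of_subst (V := V) hX h
  | .box _ V, h => Val.Free.of_subst (V := V) hX h
  | .apply V V', h => by
      rcases h with h | h
      · exact ⟨.inl (Val.Free.of_subst hX h).1, (Val.Free.of_subst hX h).2⟩
      · exact ⟨.inr (Val.Free.of_subst hX h).1, (Val.Free.of_subst hX h).2⟩
  | .ifz V N N', h => by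
      rcases h with h | h | h
      · exact ⟨.inl (Val.Free.of_subst hX h).1, (Val.Free.of_subst hX h).2⟩
      · exact ⟨.inr (.inl (Tm.Free.of_subst hX h).1), (Tm.Free.of_subst hX h).2⟩
      · exact ⟨.inr (.inr (Tm.Free.of_subst hX h).1), (Tm.Free.of_subst hX h).2⟩
  | .ret V, h => Val.Free.of_subst (V := V) hX h
  | .letin z N N', h => by
      rcases h with h | ⟨h₁, h⟩
      · exact ⟨.inl (Tm.Free.of_subst hX h).1, (Tm.Free.of_subst hX h).2⟩
      · by_cases hz : z = x
        · simp only [hz, if_true] at h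
          exact ⟨.inr ⟨h₁, h⟩, hz ▸ h₁⟩
        · simp only [hz, if_false] at h
          exact ⟨.inr ⟨h₁, (Tm.Free.of_subst hX h).1⟩, (Tm.Free.of_subst hX h).2⟩
end

/-! ### Iterated substitution -/

/-- The substitutions of a list, carried out one after the other. -/
def Val.substs (γ : List (ℕ × Val ι E)) (V : Val ι E) : Val ι E :=
  γ.foldl (fun V p => Val.subst p.1 p.2 V) V

def Tm.substs (γ : List (ℕ × Val ι E)) (N : Tm ι E) : Tm ι E :=
  γ.foldl (fun N p => N.subst p.1 p.2) N

/-- The substitutions of `γ` other than those for `x`. -/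
def without (x : ℕ) (γ : List (ℕ × Val ι E)) : List (ℕ × Val ι E) := γ.filter fun p => p.1 ≠ x

/-- All values of a list of substitutions are closed. -/
def ClosedSubst (γ : List (ℕ × Val ι E)) : Prop := ∀ p ∈ γ, p.2.Closed

theorem ClosedSubst.without {γ : List (ℕ × Val ι E)} (h : ClosedSubst γ) (x : ℕ) :
    ClosedSubst (without x γ) := fun p hp => h p (List.mem_filter.1 hp).1

theorem ClosedSubst.snoc {γ : List (ℕ × Val ι E)} (h : ClosedSubst γ) (x : ℕ) {X : Val ι E}
    (hX : X.Closed) : ClosedSubst (γ ++ [(x, X)]) := by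
  intro p hp
  rcases List.mem_append.1 hp with hp | hp
  · exact h p hp
  · rw [List.mem_singleton.1 hp]; exact hX

theorem Tm.substs_snoc (γ : List (ℕ × Val ι E)) (x : ℕ) (X : Val ι E) (N : Tm ι E) :
    N.substs (γ ++ [(x, X)]) = (N.substs γ).subst x X := by
  simp [Tm.substs]

theorem Val.substs_snoc (γ : List (ℕ × Val ι E)) (x : ℕ) (X : Val ι E) (V : Val ι E) :
    V.substs (γ ++ [(x, X)]) = Val.subst x X (V.substs γ) := by
  simp [Val.substs]

theorem Val.Closed.substs_eq {V : Val ι E} (h : V.Closed) (γ : List (ℕ × Val ι E)) :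
    V.substs γ = V := by
  induction γ with
  | nil => rfl
  | cons p γ ih => rw [Val.substs, List.foldl_cons, h.subst_eq]; exact ih

theorem Val.Free.of_substs {γ : List (ℕ × Val ι E)} (hγ : ClosedSubst γ) {V : Val ι E} {y : ℕ}
    (h : (V.substs γ).Free y) : V.Free y ∧ ∀ p ∈ γ, p.1 ≠ y := by
  induction γ generalizing V with
  | nil => exact ⟨h, by simp⟩
  | cons p γ ih =>
      obtain ⟨h₁, h₂⟩ := ih (fun q hq => hγ q (List.mem_cons_of_mem _ hq)) h
      obtain ⟨h₃, h₄⟩ := Val.Free.of_subst (hγ p List.mem_cons_self) h₁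
      exact ⟨h₃, List.forall_mem_cons.2 ⟨h₄, h₂⟩⟩

theorem Val.substs_var_of_forall_ne {γ : List (ℕ × Val ι E)} {y : ℕ} (h : ∀ p ∈ γ, p.1 ≠ y) :
    (Val.var y : Val ι E).substs γ = .var y := by
  induction γ with
  | nil => rfl
  | cons p γ ih =>
      obtain ⟨h₁, h₂⟩ := List.forall_mem_cons.1 h
      rw [Val.substs, List.foldl_cons, Val.subst, if_neg (Ne.symm h₁)]
      exact ih h₂

/-- A variable still free after the substitutions is free in `V` and is not replaced by `γ`. Then
`γ` leaves it as a variable, which is not closed. -/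
theorem Val.closed_substs {γ : List (ℕ × Val ι E)} (hγ : ClosedSubst γ) {V : Val ι E}
    (h : ∀ y, V.Free y → ((Val.var y : Val ι E).substs γ).Closed) : (V.substs γ).Closed := by
  intro y hy
  obtain ⟨h₁, h₂⟩ := Val.Free.of_substs hγ hy
  have := h y h₁ y
  rw [Val.substs_var_of_forall_ne h₂] at this
  exact this rfl

theorem Val.substs_without_snoc_var_self (γ : List (ℕ × Val ι E)) (x : ℕ) (X : Val ι E) :
    (Val.var x : Val ι E).substs (without x γ ++ [(x, X)]) = X := by
  rw [Val.substs_snoc, Val.substs_var_of_forall_ne, Val.subst, if_pos rfl]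
  intro p hp
  simpa using (List.mem_filter.1 hp).2

/-- All substituted values are closed, so the first entry for `y` decides the result and later
entries leave it alone. Entries for another variable `x` play no role. -/
theorem Val.substs_without_var {γ : List (ℕ × Val ι E)} (hγ : ClosedSubst γ) {x y : ℕ}
    (h : y ≠ x) : (Val.var y : Val ι E).substs (without x γ) = (Val.var y : Val ι E).substs γ := by
  induction γ with
  | nil => rfl
  | cons p γ ih =>
      obtain ⟨h₁, h₂⟩ := List.forall_mem_cons.1 hγ
      by_cases hp : p.1 = x
      · have : without x (p :: γ) = without x γ := by simp [without, hp]
        rw [this, ih h₂]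
        simp only [Val.substs, List.foldl_cons, Val.subst]
        rw [if_neg (fun e : y = p.1 => h (e.trans hp))]
      · have : without x (p :: γ) = p :: without x γ := by simp [without, hp]
        rw [this]
        simp only [Val.substs, List.foldl_cons, Val.subst]
        split_ifs with hy
        · exact (h₁.substs_eq _).trans (h₁.substs_eq _).symm
        · exact ih h₂

theorem Val.substs_without_snoc_var {γ : List (ℕ × Val ι E)} (hγ : ClosedSubst γ) {x y : ℕ}
    {X : Val ι E} (h : y ≠ x) (hc : ((Val.var y : Val ι E).substs γ).Closed) :
    (Val.var y : Val ι E).substs (without x γ ++ [(x, X)]) = (Val.var y : Val ι E).substs γ := by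
  rw [Val.substs_snoc, Val.substs_without_var hγ h, hc.subst_eq]

section Constructors

variable (γ : List (ℕ × Val ι E))

theorem Val.substs_pair (V V' : Val ι E) :
    (Val.pair V V').substs γ = .pair (V.substs γ) (V'.substs γ) := by
  induction γ generalizing V V' with
  | nil => rfl
  | cons p γ ih => exact ih _ _

theorem Val.substs_lift (N : Tm ι E) : (Val.lift N).substs γ = .lift (N.substs γ) := by
  induction γ generalizing N with
  | nil => rfl
  | cons p γ ih => exact ih _

/-- The bound variable shadows its own entries, whence `without x γ`. After a β-step the body is
therefore under `without x γ ++ [(x, X)]`, the form in which environments are extended in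
`EnvRel.snoc`. -/
theorem Val.substs_abs (x : ℕ) (A : Ty W E) (N : Tm ι E) :
    (Val.abs x A N).substs γ = .abs x A (N.substs (without x γ)) := by
  induction γ generalizing N with
  | nil => rfl
  | cons p γ ih =>
      rw [Val.substs, List.foldl_cons, Val.subst]
      by_cases hp : x = p.1
      · have : without x (p :: γ) = without x γ := by simp [without, hp]
        rw [if_pos hp, this]; exact ih _
      · have : without x (p :: γ) = p :: without x γ := by simp [without, Ne.symm hp]
        rw [if_neg hp, this]; exact ih _

theorem Tm.substs_app (V V' : Val ι E) :
    (Tm.app V V').substs γ = .app (V.substs γ) (V'.substs γ) := by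
  induction γ generalizing V V' with
  | nil => rfl
  | cons p γ ih => exact ih _ _

theorem Tm.substs_apply (V V' : Val ι E) :
    (Tm.apply V V').substs γ = .apply (V.substs γ) (V'.substs γ) := by
  induction γ generalizing V V' with
  | nil => rfl
  | cons p γ ih => exact ih _ _

theorem Tm.substs_force (V : Val ι E) : (Tm.force V).substs γ = .force (V.substs γ) := by
  induction γ generalizing V with
  | nil => rfl
  | cons p γ ih => exact ih _

theorem Tm.substs_box (T : BTy W) (V : Val ι E) : (Tm.box T V).substs γ = .box T (V.substs γ) := by
  induction γ generalizing V with
  | nil => rfl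
  | cons p γ ih => exact ih _

theorem Tm.substs_ret (V : Val ι E) : (Tm.ret V).substs γ = .ret (V.substs γ) := by
  induction γ generalizing V with
  | nil => rfl
  | cons p γ ih => exact ih _

theorem Tm.substs_ifz (V : Val ι E) (N N' : Tm ι E) :
    (Tm.ifz V N N').substs γ = .ifz (V.substs γ) (N.substs γ) (N'.substs γ) := by
  induction γ generalizing V N N' with
  | nil => rfl
  | cons p γ ih => exact ih _ _ _

theorem Tm.substs_letin (x : ℕ) (N N' : Tm ι E) :
    (Tm.letin x N N').substs γ = .letin x (N.substs γ) (N'.substs (without x γ)) := by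
  induction γ generalizing N N' with
  | nil => rfl
  | cons p γ ih =>
      rw [Tm.substs, List.foldl_cons, Tm.subst]
      by_cases hp : x = p.1
      · have : without x (p :: γ) = without x γ := by simp [without, hp]
        rw [if_pos hp, this]; exact ih _ _
      · have : without x (p :: γ) = p :: without x γ := by simp [without, Ne.symm hp]
        rw [if_neg hp, this]; exact ih _ _

theorem Tm.substs_dest (x y : ℕ) (V : Val ι E) (N : Tm ι E) :
    (Tm.dest x y V N).substs γ =
      .dest x y (V.substs γ) (N.substs (without y (without x γ))) := by
  induction γ generalizing V N with
  | nil => rfl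
  | cons p γ ih =>
      rw [Tm.substs, List.foldl_cons, Tm.subst]
      by_cases hp : x = p.1 ∨ y = p.1
      · have : without y (without x (p :: γ)) = without y (without x γ) := by
          rcases hp with hp | hp
          · simp [without, hp]
          · by_cases hx : p.1 = x <;> simp [without, hp, hx]
        rw [if_pos hp, this]; exact ih _ _
      · have : without y (without x (p :: γ)) = p :: without y (without x γ) := by
          obtain ⟨h₁, h₂⟩ := not_or.1 hp
          simp [without, Ne.symm h₁, Ne.symm h₂]
        rw [if_neg hp, this]; exact ih _ _

end Constructors

end Substitution

/-! ### Free variables of typed terms -/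

section Typing

variable {M : Type u} [Category.{v} M] [StrictSymPremonoidal M]
  {E : Type u'} [Category.{v'} E] [CircuitAlgebra E] {α : Abstraction M E} {W : Type w} {ι : W → M}

mutual
-- Together with `EnvRel.closed_var` and `Val.closed_substs`, this makes abstractions and thunks
-- closed once an environment is substituted.
theorem VTy.free_mem {x : ℕ} : ∀ {Γ : Ctx W E} {V : Val ι E} {A : Ty W E},
    VTy α Γ V A → V.Free x → ∃ B, Entry.var x B ∈ Γ
  | _, _, _, .unit _ _, h => h.elim
  | _, _, _, .nat _ _ _, h => h.elim
  | _, _, _, .lab _ _ _ _, h => h.elim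
  | _, _, _, .var y A _ _, h => ⟨A, by have h : y = x := h; simp [h]⟩
  | _, _, _, .abs (x := y) d, h => by
      obtain ⟨B, hB⟩ := d.free_mem h.2
      have := h.1
      exact ⟨B, by simpa [Ne.symm this] using hB⟩
  | _, _, _, .lift _ d, h => CTy.free_mem d h
  | _, _, _, .circ _ _ _ _ _ _ _ _ _, h => h.elim
  | _, _, _, .pair _ _ d d', h => by
      rcases h with h | h
      · obtain ⟨B, hB⟩ := d.free_mem h
        exact ⟨B, by simp only [List.mem_append] at hB ⊢; tauto⟩
      · obtain ⟨B, hB⟩ := d'.free_mem h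
        exact ⟨B, by simp only [List.mem_append] at hB ⊢; tauto⟩
theorem CTy.free_mem {x : ℕ} : ∀ {Γ : Ctx W E} {N : Tm ι E} {A : Ty W E} {e : Eff E},
    CTy α Γ N A e → N.Free x → ∃ B, Entry.var x B ∈ Γ
  | _, _, _, _, .app _ _ d d', h => by
      rcases h with h | h
      · obtain ⟨B, hB⟩ := d.free_mem h
        exact ⟨B, by simp only [List.mem_append] at hB ⊢; tauto⟩
      · obtain ⟨B, hB⟩ := d'.free_mem h
        exact ⟨B, by simp only [List.mem_append] at hB ⊢; tauto⟩
  | _, _, _, _, .force _ d, h => VTy.free_mem d h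
  | _, _, _, _, .box _ d, h => VTy.free_mem d h
  | _, _, _, _, .apply _ _ d d', h => by
      rcases h with h | h
      · obtain ⟨B, hB⟩ := d.free_mem h
        exact ⟨B, by simp only [List.mem_append] at hB ⊢; tauto⟩
      · obtain ⟨B, hB⟩ := d'.free_mem h
        exact ⟨B, by simp only [List.mem_append] at hB ⊢; tauto⟩
  | _, _, _, _, .dest _ _ d d', h => by
      rcases h with h | ⟨h₁, h₂, h⟩
      · obtain ⟨B, hB⟩ := d.free_mem h
        exact ⟨B, by simp only [List.mem_append] at hB ⊢; tauto⟩
      · obtain ⟨B, hB⟩ := d'.free_mem h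
        refine ⟨B, ?_⟩
        simp only [List.mem_append, List.mem_cons, Entry.var.injEq, Ne.symm h₁, Ne.symm h₂,
          false_and, List.not_mem_nil, or_false] at hB ⊢
        tauto
  | _, _, _, _, .ifz _ d d₀ d₁, h => by
      rcases h with h | h | h
      · obtain ⟨B, hB⟩ := d.free_mem h
        exact ⟨B, List.mem_append_left _ hB⟩
      · exact d₀.free_mem h
      · exact d₁.free_mem h
  | _, _, _, _, .ret d, h => VTy.free_mem d h
  | _, _, _, _, .letin _ _ d d', h => by
      rcases h with h | ⟨h₁, h⟩
      · obtain ⟨B, hB⟩ := d.free_mem h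
        exact ⟨B, by simp only [List.mem_append] at hB ⊢; tauto⟩
      · obtain ⟨B, hB⟩ := d'.free_mem h
        refine ⟨B, ?_⟩
        simp only [List.mem_append, List.mem_cons, Entry.var.injEq, Ne.symm h₁,
          false_and, List.not_mem_nil, or_false] at hB ⊢
        tauto
  | _, _, _, _, .sub d _, h => CTy.free_mem d h
  | _, _, _, _, .ex d, h => by
      obtain ⟨B, hB⟩ := d.free_mem h
      refine ⟨B, ?_⟩
      simp only [List.mem_append, List.mem_cons] at hB ⊢
      tauto
end

/-! ### Typing contexts have distinct names -/

mutual
-- Distinctness, applied to the body of a binder, shows that the bound variable is new to the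
-- surrounding context, as the extension of environments requires.
theorem VTy.ctx_distinct : ∀ {Γ : Ctx W E} {V : Val ι E} {A : Ty W E}, VTy α Γ V A → Γ.Distinct
  | _, _, _, .unit _ h => h
  | _, _, _, .nat _ _ h => h
  | _, _, _, .lab _ _ _ h => h
  | _, _, _, .var _ _ _ h => h
  | _, _, _, .abs d => by
      have := d.ctx_distinct
      rw [Ctx.Distinct, List.map_append] at this
      exact this.of_append_left
  | _, _, _, .lift _ d => d.ctx_distinct
  | _, _, _, .circ _ _ h _ _ _ _ _ _ => h
  | _, _, _, .pair _ h _ _ => h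
theorem CTy.ctx_distinct : ∀ {Γ : Ctx W E} {N : Tm ι E} {A : Ty W E} {e : Eff E},
    CTy α Γ N A e → Γ.Distinct
  | _, _, _, _, .app _ h _ _ => h
  | _, _, _, _, .force _ d => d.ctx_distinct
  | _, _, _, _, .box _ d => d.ctx_distinct
  | _, _, _, _, .apply _ h _ _ => h
  | _, _, _, _, .dest _ h _ _ => h
  | _, _, _, _, .ifz _ _ d _ => d.ctx_distinct
  | _, _, _, _, .ret d => d.ctx_distinct
  | _, _, _, _, .letin _ h _ _ => h
  | _, _, _, _, .sub d _ => d.ctx_distinct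
  | _, _, _, _, .ex d => by
      have := d.ctx_distinct
      refine ((List.Perm.append_left _ (List.Perm.swap _ _ _)).map _).nodup_iff.1 this
end

end Typing

-- Computability of terms in an arbitrary frame of unused labels.

section Computability

variable {M : Type u} [Category.{v} M] [StrictSymPremonoidal M] {W : Type w} {ι : W → M}
  {E : Type u'} [Category.{v'} E]

theorem LCtx.wires_append_of_eq {Q : LCtx W} {S : List W} (h : Q.wires = S) (R : LCtx W) :
    LCtx.wires (Q ++ R) = S ++ R.wires := by
  rw [LCtx.wires_append, h]

theorem whiskR_wires_append {S₁ S₂ : List W} (F : Circ ι S₁ S₂) (Q R : LCtx W) :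
    whiskR ι F (LCtx.wires (Q ++ R)) =
      idc ι (by rw [LCtx.wires_append, List.append_assoc]) ≫
        whiskR ι (whiskR ι F Q.wires) R.wires ≫
          idc ι (by rw [LCtx.wires_append, List.append_assoc]) :=
  eq_conj_idc_of_heq _ _ ((whiskR_congr_heq (LCtx.wires_append Q R) rfl rfl HEq.rfl).trans
    ((heq_of_eq (whiskR_append F _ _)).trans (conj_idc_heq _ _ _)))

/-- The term `N`, which uses the labels `Q`, evaluates to a value related to `b` by `P`, and produces
the circuit `F`: on every circuit whose outputs are `Q` and further labels `R`, in any order. -/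
def Computes {S S' : List W} {X : Type v} (P : LCtx W → Val ι E → X → Prop) (Q : LCtx W)
    (N : Tm ι E) (b : X) (F : Circ ι S S') : Prop :=
  ∃ hS : Q.wires = S, ∀ {Q₀ : LCtx W} (C : LCirc ι Q₀) (R : LCtx W) (π : LPerm C.cod (Q ++ R)),
    C.cod.Distinct → ∃ (D : LCirc ι Q₀) (V : Val ι E) (Q' : LCtx W) (hS' : Q'.wires = S')
      (π' : LPerm D.cod (Q' ++ R)), Eval C N D V ∧ D.cod.Distinct ∧ P Q' V b ∧
        D.hom ≫ π'.circ ι = C.hom ≫ π.circ ι ≫ idc ι (LCtx.wires_append_of_eq hS R) ≫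
          whiskR ι F R.wires ≫ idc ι (LCtx.wires_append_of_eq hS' R).symm

namespace Computes

variable {S S' : List W} {X Y : Type v} {P : LCtx W → Val ι E → X → Prop} {Q : LCtx W}
  {N : Tm ι E} {b : X} {F : Circ ι S S'}

theorem cast (h : Computes P Q N b F) {S₁ S₁' : List W} (h₁ : S₁ = S) (h₂ : S' = S₁') :
    Computes P Q N b (idc ι h₁ ≫ F ≫ idc ι h₂ : Circ ι S₁ S₁') := by
  subst h₁ h₂; simpa using h

theorem of_eval (h : Computes P Q N b F) {N' : Tm ι E}
    (hN : ∀ {Q₀ : LCtx W} {C D : LCirc ι Q₀} {V : Val ι E}, Eval C N D V → Eval C N' D V) :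
    Computes P Q N' b F := by
  obtain ⟨hS, h⟩ := h
  refine ⟨hS, fun C R π hC => ?_⟩
  obtain ⟨D, V, Q', hS', π', hD, h'⟩ := h C R π hC
  exact ⟨D, V, Q', hS', π', hN hD, h'⟩

theorem ret {V : Val ι E} (hQ : Q.wires = S) (h : P Q V b) :
    Computes P Q (.ret V) b (𝟙 _ : Circ ι S S) := by
  subst hQ
  refine ⟨rfl, fun C R π hC => ⟨C, V, Q, rfl, π, .ret, hC, h, ?_⟩⟩
  rw [whiskR_id]
  simp

/-- The reordering `σ`, acting beside the frame, is absorbed into the permutation with which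
`Computes` is instantiated. This handles the exchange rule. -/
theorem precomp (h : Computes P Q N b F) {Q₁ : LCtx W} {S₁ : List W} (σ : LPerm Q₁ Q)
    (hQ₁ : Q₁.wires = S₁) {G : Circ ι S₁ S} (hG : σ.circ ι ≍ G) :
    Computes P Q₁ N b (G ≫ F : Circ ι S₁ S') := by
  obtain ⟨hS, h⟩ := h
  subst hS hQ₁
  cases hG
  refine ⟨rfl, fun C R π hC => ?_⟩
  obtain ⟨D, V, Q', hS', π', hD, hDd, hV, e⟩ := h C R (π.trans (σ.appendRight R)) hC
  refine ⟨D, V, Q', hS', π', hD, hDd, hV, ?_⟩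
  rw [e, LPerm.circ, LPerm.circ_appendRight, whiskR_comp]
  simp

/-- While the first term runs, the labels `Q₂` kept for the continuation belong to the frame. They
are exchanged with `Q₁` beforehand and with the result's labels `Q₁'` afterwards, so that `F ⋉ S`
conjugated by symmetries becomes `S ⋊ F`. -/
theorem letin {Q₁ Q₂ : LCtx W} {S₁ S₁' S₂ : List W} {P' : LCtx W → Val ι E → Y → Prop}
    {x : ℕ} {N' : Tm ι E} {c : Y} {F : Circ ι S₁ S₁'} {G : Circ ι (S ++ S₁') S₂}
    (hQ₂ : Q₂.wires = S) (h : Computes P Q₁ N b F)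
    (h' : ∀ Q₁' V, P Q₁' V b → Computes P' (Q₂ ++ Q₁') (N'.subst x V) c G) :
    Computes P' (Q₂ ++ Q₁) (.letin x N N') c (whiskL ι S F ≫ G : Circ ι (S ++ S₁) S₂) := by
  obtain ⟨hS, h⟩ := h
  subst hS hQ₂
  refine ⟨LCtx.wires_append _ _, fun C R π hC => ?_⟩
  -- The frame of the first evaluation is `Q₂ ++ R`, so `Q₁` has to be brought to the front.
  obtain ⟨C', V, Q₁', hS', π', hC', hC'd, hV, e⟩ := h C (Q₂ ++ R)
    (π.trans (((LPerm.swapBlocks Q₂ Q₁).appendRight R).trans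
      (.ofEq (List.append_assoc Q₁ Q₂ R)))) hC
  subst hS'
  obtain ⟨hS'', h'⟩ := h' Q₁' V hV
  obtain ⟨D, V', Q', hT, π'', hD, hDd, hV', e'⟩ := h' C' R
    (π'.trans ((LPerm.ofEq (List.append_assoc Q₁' Q₂ R).symm).trans
      ((LPerm.swapBlocks Q₁' Q₂).appendRight R))) hC'd
  refine ⟨D, V', Q', hT, π'', .letin hC' hD, hDd, hV', ?_⟩
  -- Expressing `S ⋊ F` through `F ⋉ S` makes both sides the same composite of right whiskerings and
  -- symmetries; only transports remain to be merged.
  rw [e', LPerm.circ, Category.assoc, ← Category.assoc C'.hom, e, ← swapc_whiskR_swapc]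
  simp only [LPerm.circ, LPerm.circ_appendRight, LPerm.circ_ofEq, LPerm.circ_swapBlocks,
    whiskR_wires_append, whiskR_comp, whiskR_idc, Category.assoc, idc_comp_idc,
    idc_comp_idc_assoc, idc_rfl, Category.id_comp]

end Computes

theorem Bundle.exists_fresh (T : BTy W) (s : List ℕ) : ∃ (Q : LCtx W) (l : Bundle),
    l.HasTy Q T ∧ Q.Distinct ∧ ∀ x ∈ Q.map Prod.fst, x ∉ s := by
  induction T generalizing s with
  | unit => exact ⟨[], .unit, .unit, List.nodup_nil, by simp⟩
  | wire a =>
      obtain ⟨n, hn⟩ := Infinite.exists_notMem_finset s.toFinset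
      exact ⟨[(n, a)], .lab n, .lab n a, by simp [LCtx.Distinct], by simpa using hn⟩
  | tensor T U ihT ihU =>
      obtain ⟨Q, l, hl, hQ, hs⟩ := ihT s
      obtain ⟨Q', l', hl', hQ', hs'⟩ := ihU (s ++ Q.map Prod.fst)
      refine ⟨Q ++ Q', .pair l l', .pair hl hl', ?_, ?_⟩
      · rw [LCtx.Distinct, List.map_append]
        exact List.Nodup.append hQ hQ' fun x hx hx' =>
          hs' x hx' (List.mem_append_right _ hx)
      · intro x hx
        rw [List.map_append, List.mem_append] at hx
        rcases hx with hx | hx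
        · exact hs x hx
        · exact fun h => hs' x hx (List.mem_append_left _ h)

end Computability

-- The logical relation on values and environments.

section LogicalRelation

variable {M : Type u} [Category.{v} M] [StrictSymPremonoidal M]
  {E : Type u'} [Category.{v'} E] [CircuitAlgebra E] {α : Abstraction M E} {W : Type w} {ι : W → M}

/-- The logical relation between closed values, with the labels that they use, and elements of the
interpretation of a type. -/
def VRel : ∀ A : Ty W E, LCtx W → Val ι E → A.flat α ι → Prop
  | .unit, Q, V, _ => Q = [] ∧ V = .unit
  | .nat, Q, V, n => Q = [] ∧ V = .nat n.down
  | .wire a, Q, V, _ => ∃ l, Q = [(l, a)] ∧ V = .lab l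
  | .tensor A B, Q, V, p => ∃ Q₁ Q₂ V₁ V₂, Q = Q₁ ++ Q₂ ∧ V = .pair V₁ V₂ ∧
      VRel A Q₁ V₁ p.1 ∧ VRel B Q₂ V₂ p.2
  | .arrow A B S _, Q, V, f => Q.wires = S ∧ V.Closed ∧ ∀ Q' V' a, VRel A Q' V' a →
      Computes (VRel B) (Q ++ Q') (.app V V') (f a).1 (f a).2.1
  | .bang A _, Q, V, r => Q = [] ∧ V.Closed ∧ Computes (VRel A) [] (.force V) r.1 r.2.1
  | .circ T U _, Q, V, F => Q = [] ∧ ∃ (P P' L L' : LCtx W) (l k : Bundle)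
      (G : Circ ι P.wires L.wires) (σ : LPerm P' P) (τ : LPerm L L') (hl : l.HasTy P' T)
      (hk : k.HasTy L' U), P.Distinct ∧ L.Distinct ∧ V = .boxed l P L G k ∧
        boxMor ι σ τ hl hk G = F.1

theorem VRel.wires_eq : ∀ {A : Ty W E} {Q : LCtx W} {V : Val ι E} {a : A.flat α ι},
    VRel A Q V a → Q.wires = A.sharp
  | .unit, _, _, _, h => by rw [h.1]; rfl
  | .nat, _, _, _, h => by rw [h.1]; rfl
  | .wire _, _, _, _, ⟨_, h, _⟩ => by rw [h]; rfl
  | .tensor A B, _, _, _, ⟨_, _, _, _, h, _, h₁, h₂⟩ => by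
      rw [h, LCtx.wires_append, h₁.wires_eq, h₂.wires_eq]; rfl
  | .arrow _ _ _ _, _, _, _, h => h.1
  | .bang _ _, _, _, _, h => by rw [h.1]; rfl
  | .circ _ _ _, _, _, _, h => by rw [h.1]; rfl

theorem VRel.closed : ∀ {A : Ty W E} {Q : LCtx W} {V : Val ι E} {a : A.flat α ι},
    VRel A Q V a → V.Closed
  | .unit, _, _, _, h => by rw [h.2]; exact fun _ h => h
  | .nat, _, _, _, h => by rw [h.2]; exact fun _ h => h
  | .wire _, _, _, _, ⟨_, _, h⟩ => by rw [h]; exact fun _ h => h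
  | .tensor A B, _, _, _, ⟨_, _, _, _, _, h, h₁, h₂⟩ => by
      rw [h]
      exact fun x hx => hx.elim (h₁.closed x) (h₂.closed x)
  | .arrow _ _ _ _, _, _, _, h => h.2.1
  | .bang _ _, _, _, _, h => h.2.1
  | .circ _ _ _, _, _, _, ⟨_, _, _, _, _, _, _, _, _, _, _, _, _, _, h, _⟩ => by
      rw [h]; exact fun _ h => h

/-- At bundle types the relation is just the typing of bundles, since `♭T` has a single element;
hence `a` is arbitrary. `VRel.exists_hasTy` is the converse. -/
theorem VRel.of_hasTy {T : BTy W} {Q : LCtx W} {l : Bundle} (h : l.HasTy Q T)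
    (a : (T.toTy : Ty W E).flat α ι) : VRel T.toTy Q (l.toVal : Val ι E) a := by
  induction h with
  | unit => exact ⟨rfl, rfl⟩
  | lab l b => exact ⟨l, rfl, rfl⟩
  | pair _ _ ih ih' => exact ⟨_, _, _, _, rfl, rfl, ih a.1, ih' a.2⟩

theorem VRel.exists_hasTy : ∀ {T : BTy W} {Q : LCtx W} {V : Val ι E}
    {a : (T.toTy : Ty W E).flat α ι}, VRel T.toTy Q V a → ∃ l : Bundle, V = l.toVal ∧ l.HasTy Q T
  | .unit, _, _, _, ⟨h, h'⟩ => ⟨.unit, h', h ▸ .unit⟩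
  | .wire b, _, _, _, ⟨l, h, h'⟩ => ⟨.lab l, h', h ▸ .lab l b⟩
  | .tensor T U, _, _, _, ⟨Q₁, Q₂, V₁, V₂, h, h', h₁, h₂⟩ => by
      obtain ⟨l, rfl, hl⟩ := VRel.exists_hasTy (T := T) h₁
      obtain ⟨k, rfl, hk⟩ := VRel.exists_hasTy (T := U) h₂
      exact ⟨.pair l k, h', h ▸ .pair hl hk⟩

theorem LCtx.eq_nil_of_wires_eq_nil {Q : LCtx W} (h : Q.wires = []) : Q = [] :=
  List.map_eq_nil_iff.1 h

/-- A boxed circuit uses no labels and its argument is a bundle of labels, so the evaluation rule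
applies once output labels fresh for the frame are chosen. The circuit built by `LCirc.append` is
already of the form demanded by `Computes`. -/
theorem Computes.apply {T U : BTy W} {e : Eff E} {Q Q' : LCtx W} {V V' : Val ι E}
    {F : (Ty.circ T U e : Ty W E).flat α ι} {a : (T.toTy : Ty W E).flat α ι}
    (hV : VRel (.circ T U e) Q V F) (hV' : VRel T.toTy Q' V' a)
    (b : (U.toTy : Ty W E).flat α ι) :
    Computes (VRel U.toTy) (Q ++ Q') (.apply V V') b F.1 := by
  obtain ⟨rfl, P, P', L, L', l, k, G, σ, τ, hl, hk, hP, hL, rfl, hF⟩ := hV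
  obtain ⟨t, rfl, ht⟩ := hV'.exists_hasTy
  change Computes _ Q' _ _ _
  refine ⟨ht.wires_eq, fun C R π hC => ?_⟩
  obtain ⟨K, k', hk', hK, hKR⟩ := Bundle.exists_fresh U (R.map Prod.fst)
  have hR : LCtx.Distinct R := by
    have := π.distinct_iff.1 hC
    rw [LCtx.Distinct, List.map_append] at this
    exact this.of_append_right
  have hd : LCtx.Distinct (K ++ R) := by
    rw [LCtx.Distinct, List.map_append]
    exact List.Nodup.append hK hR fun x hx hx' => hKR x hx hx'
  refine ⟨C.append π ht hk' (boxMor ι σ τ hl hk G), k'.toVal, K, hk'.wires_eq, .refl (K ++ R),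
    .apply hP hL σ τ hl hk hC π ht hk' hd, hd, VRel.of_hasTy hk' b, ?_⟩
  refine (congrArg (_ ≫ ·) (LPerm.circ_refl (K ++ R))).trans ((Category.comp_id _).trans ?_)
  simp only [LCirc.append, hF, whiskR_comp, whiskR_idc]
  exact congrArg (C.hom ≫ π.circ ι ≫ ·) (eq_of_heq ((conj_idc_heq _ _ _).trans
    ((conj_idc_heq _ _ _).trans (conj_idc_heq _ _ _).symm)))

/-- A boxable function captures no wires, so it can be run in isolation on a fresh bundle, from the
identity circuit and with an empty frame. The permutation of outputs supplied by `Computes` becomes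
part of the output permutation of the boxed circuit, which therefore denotes exactly the circuit of
`f`. -/
theorem Computes.box {T U : BTy W} {e : Eff E} {Q : LCtx W} {V : Val ι E}
    {f : (Ty.arrow T.toTy U.toTy [] e : Ty W E).flat α ι}
    (hV : VRel (.arrow T.toTy U.toTy [] e) Q V f) :
    Computes (VRel (.circ T U e)) Q (.box T V)
      ((f (BTy.point α ι T)).2.cast (BTy.sharp_toTy T).symm (BTy.sharp_toTy U))
      (𝟙 _ : Circ ι [] []) := by
  obtain ⟨hQ, -, h⟩ := hV
  obtain rfl := LCtx.eq_nil_of_wires_eq_nil hQ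
  obtain ⟨P, l, hl, hP, -⟩ := Bundle.exists_fresh T []
  obtain ⟨hS, h⟩ := h P l.toVal (BTy.point α ι T) (.of_hasTy hl _)
  obtain ⟨D, V', Q', hS', π', hD, hDd, hV', e'⟩ := h ⟨P, 𝟙 _⟩ []
    (.ofEq (List.append_nil P).symm) hP
  obtain ⟨k, rfl, hk⟩ := hV'.exists_hasTy
  refine ⟨rfl, fun C R π hC => ⟨C, _, [], rfl, π, .box hl hP hD, hC, ⟨rfl, P, P, D.cod, Q', l, k,
    D.hom, .refl P, π'.trans (.ofEq (List.append_nil Q')), hl, hk, hP, hDd, rfl, ?_⟩, ?_⟩⟩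
  · rw [boxMor, LPerm.circ, LPerm.circ_refl, LPerm.circ_ofEq]
    change _ = idc ι _ ≫ (f (BTy.point α ι T)).2.1 ≫ idc ι _
    rw [Category.assoc, ← Category.assoc D.hom, e', LPerm.circ_ofEq]
    have hn := whiskR_nil (ι := ι) (f (BTy.point α ι T)).2.1
    change whiskR ι (f (BTy.point α ι T)).2.1 (LCtx.wires []) = _ at hn
    rw [hn]
    simp only [Category.assoc, Category.id_comp, idc_comp_idc, idc_comp_idc_assoc]
    exact eq_of_heq ((conj_idc_heq _ _ _).trans ((comp_eqToHom_heq_self _ _).trans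
      ((conj_idc_heq _ _ _).trans (conj_idc_heq _ _ _).symm)))
  · rw [whiskR_id]
    simp

/-! ### Environments -/

/-- The logical relation for the entries of typing contexts, under the substitution `γ`. -/
def Entry.Rel (γ : List (ℕ × Val ι E)) : ∀ a : Entry W E, LCtx W → a.ty.flat α ι → Prop
  | .var x A, Q, v => VRel A Q ((Val.var x).substs γ) v
  | .lab l a, Q, _ => Q = [(l, a)]

/-- The logical relation for typing contexts. -/
def EnvRel (γ : List (ℕ × Val ι E)) : ∀ Γ : Ctx W E, LCtx W → Env α ι Γ → Prop
  | [], Q, _ => Q = []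
  | a :: Γ, Q, ρ => ∃ Q₁ Q₂, Q = Q₁ ++ Q₂ ∧ a.Rel γ Q₁ ρ.1 ∧ EnvRel γ Γ Q₂ ρ.2

theorem Entry.Rel.wires_eq {γ : List (ℕ × Val ι E)} : ∀ {a : Entry W E} {Q : LCtx W}
    {v : a.ty.flat α ι}, a.Rel γ Q v → Q.wires = a.ty.sharp
  | .var _ _, _, _, h => VRel.wires_eq h
  | .lab _ _, _, _, h => by rw [show _ = _ from h]; rfl

namespace EnvRel

variable {γ : List (ℕ × Val ι E)}

theorem wires_eq : ∀ {Γ : Ctx W E} {Q : LCtx W} {ρ : Env α ι Γ}, EnvRel γ Γ Q ρ →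
    Q.wires = Γ.sharp
  | [], _, _, h => by rw [show _ = _ from h]; rfl
  | a :: Γ, _, _, ⟨_, _, h, h₁, h₂⟩ => by
      rw [h, LCtx.wires_append, h₁.wires_eq, h₂.wires_eq]; rfl

theorem eq_nil {Γ : Ctx W E} (hΓ : Γ.IsParam) {Q : LCtx W} {ρ : Env α ι Γ} (h : EnvRel γ Γ Q ρ) :
    Q = [] :=
  LCtx.eq_nil_of_wires_eq_nil (h.wires_eq.trans hΓ.sharp_eq)

theorem split : ∀ {Γ Δ : Ctx W E} {Q : LCtx W} {ρ : Env α ι (Γ ++ Δ)}, EnvRel γ (Γ ++ Δ) Q ρ →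
    ∃ Q₁ Q₂, Q = Q₁ ++ Q₂ ∧ EnvRel γ Γ Q₁ ρ.left ∧ EnvRel γ Δ Q₂ ρ.right
  | [], _, Q, _, h => ⟨[], Q, rfl, rfl, h⟩
  | a :: Γ, _, _, _, ⟨Q₁, Q₂, h, h₁, h₂⟩ => by
      obtain ⟨Q₃, Q₄, rfl, h₃, h₄⟩ := h₂.split
      exact ⟨Q₁ ++ Q₃, Q₄, by rw [h, List.append_assoc], ⟨_, _, rfl, h₁, h₃⟩, h₄⟩

theorem append : ∀ {Γ Δ : Ctx W E} {Q Q' : LCtx W} {ρ : Env α ι Γ} {σ : Env α ι Δ},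
    EnvRel γ Γ Q ρ → EnvRel γ Δ Q' σ → EnvRel γ (Γ ++ Δ) (Q ++ Q') (ρ.append σ)
  | [], _, _, _, _, _, h, h' => by
      rw [show _ = _ from h]; exact h'
  | a :: Γ, _, _, _, _, _, ⟨_, _, h, h₁, h₂⟩, h' => by
      rw [h, List.append_assoc]
      exact ⟨_, _, rfl, h₁, h₂.append h'⟩

theorem one {a : Entry W E} {Q : LCtx W} {v : a.ty.flat α ι} (h : a.Rel γ Q v) :
    EnvRel γ [a] Q (Env.one v) :=
  ⟨Q, [], (List.append_nil Q).symm, h, rfl⟩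

theorem of_one {a : Entry W E} {Q : LCtx W} {ρ : Env α ι [a]} (h : EnvRel γ [a] Q ρ) :
    a.Rel γ Q ρ.1 := by
  obtain ⟨Q₁, Q₂, rfl, h₁, h₂⟩ := h
  rw [show Q₂ = [] from h₂, List.append_nil]; exact h₁

theorem ofLabels : ∀ Q : LCtx W, EnvRel (α := α) γ Q.toCtx Q (Env.ofLabels Q)
  | [] => rfl
  | a :: Q => ⟨[a], Q, rfl, rfl, ofLabels Q⟩

theorem closed_var {x : ℕ} {A : Ty W E} : ∀ {Γ : Ctx W E} {Q : LCtx W} {ρ : Env α ι Γ},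
    EnvRel γ Γ Q ρ → Entry.var x A ∈ Γ → ((Val.var x : Val ι E).substs γ).Closed
  | a :: Γ, _, _, ⟨_, _, _, h₁, h₂⟩, hx => by
      rcases List.mem_cons.1 hx with hx | hx
      · subst hx; exact VRel.closed h₁
      · exact h₂.closed_var hx

/-- The substitution matters only through its effect on the variables of the context, so it may be
changed freely at a variable newly bound. -/
theorem congr {γ' : List (ℕ × Val ι E)} : ∀ {Γ : Ctx W E} {Q : LCtx W} {ρ : Env α ι Γ},
    EnvRel γ Γ Q ρ → (∀ x A, Entry.var x A ∈ Γ →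
      (Val.var x : Val ι E).substs γ' = (Val.var x : Val ι E).substs γ) → EnvRel γ' Γ Q ρ
  | [], _, _, h, _ => h
  | .var x A :: Γ, _, _, ⟨_, _, h, h₁, h₂⟩, hx =>
      ⟨_, _, h, by
        have := hx x A List.mem_cons_self
        simp only [Entry.Rel] at h₁ ⊢
        rwa [this], h₂.congr fun y B hy => hx y B (List.mem_cons_of_mem _ hy)⟩
  | .lab l a :: Γ, _, _, ⟨_, _, h, h₁, h₂⟩, hx =>
      ⟨_, _, h, h₁, h₂.congr fun y B hy => hx y B (List.mem_cons_of_mem _ hy)⟩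

/-- Extending an environment by a variable. -/
theorem snoc (hγ : ClosedSubst γ) {Γ : Ctx W E} {Q Q' : LCtx W} {ρ : Env α ι Γ} {x : ℕ}
    {A : Ty W E} {X : Val ι E} {v : A.flat α ι} (h : EnvRel γ Γ Q ρ) (hX : VRel A Q' X v)
    (hx : ∀ B, Entry.var x B ∉ Γ) :
    EnvRel (without x γ ++ [(x, X)]) (Γ ++ [.var x A]) (Q ++ Q')
      (ρ.append (Env.one (a := .var x A) v)) := by
  refine append (h.congr fun y B hy => ?_) (one ?_)
  · exact Val.substs_without_snoc_var hγ (fun e : y = x => hx B (e ▸ hy)) (h.closed_var hy)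
  · change VRel A Q' _ v
    rwa [Val.substs_without_snoc_var_self]

/-- Extending an environment by two variables. -/
theorem snoc_snoc (hγ : ClosedSubst γ) {Γ : Ctx W E} {Q Q₁ Q₂ : LCtx W} {ρ : Env α ι Γ} {x y : ℕ}
    {A B : Ty W E} {X Y : Val ι E} {v : A.flat α ι} {v' : B.flat α ι} (h : EnvRel γ Γ Q ρ)
    (hX : VRel A Q₁ X v) (hY : VRel B Q₂ Y v') (hx : ∀ D, Entry.var x D ∉ Γ)
    (hy : ∀ D, Entry.var y D ∉ Γ) (hxy : x ≠ y) :
    EnvRel (without y (without x γ) ++ [(x, X)] ++ [(y, Y)]) (Γ ++ ([.var x A] ++ [.var y B]))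
      (Q ++ (Q₁ ++ Q₂))
      (ρ.append ((Env.one (a := .var x A) v).append (Env.one (a := .var y B) v'))) := by
  have hγ' : ClosedSubst (without x γ ++ [(x, X)]) := (hγ.without x).snoc x hX.closed
  -- As `x ≠ y`, discarding the entries for `y` keeps `(x, X)`. The pair of extensions is thus two
  -- extensions by one variable.
  have he : without y (without x γ) ++ [(x, X)] = without y (without x γ ++ [(x, X)]) := by
    simp [without, hxy]
  rw [he]
  refine append (h.congr fun z D hz => ?_) (append (one ?_) (one ?_))
  · have hc := h.closed_var hz
    have := Val.substs_without_snoc_var hγ (X := X) (fun e : z = x => hx D (e ▸ hz)) hc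
    rw [Val.substs_without_snoc_var hγ' (fun e : z = y => hy D (e ▸ hz)) (this ▸ hc), this]
  · change VRel A Q₁ _ v
    have := Val.substs_without_snoc_var_self γ x X
    rwa [Val.substs_without_snoc_var hγ' hxy (this.symm ▸ hX.closed), this]
  · change VRel B Q₂ _ v'
    rwa [Val.substs_without_snoc_var_self]

/-- Splitting a context whose parameters are shared. -/
theorem split_param {Φ Γ Δ : Ctx W E} (hΦ : Φ.IsParam) {Q : LCtx W} {ρ : Env α ι (Φ ++ Γ ++ Δ)}
    (h : EnvRel γ (Φ ++ Γ ++ Δ) Q ρ) : ∃ Q₁ Q₂, Q = Q₁ ++ Q₂ ∧ EnvRel γ (Φ ++ Γ) Q₁ ρ.left ∧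
      EnvRel γ (Φ ++ Γ) Q₁ (ρ.left.left.append ρ.left.right) ∧
      EnvRel γ (Φ ++ Δ) Q₂ (ρ.left.left.append ρ.right) := by
  obtain ⟨Q₁, Q₂, rfl, h₁, h₂⟩ := h.split
  obtain ⟨Q₀, Q₁, rfl, h₀, h₁'⟩ := h₁.split
  -- Parameters carry no labels, so their part of the environment may be used on both sides without
  -- duplicating a wire.
  obtain rfl := h₀.eq_nil hΦ
  exact ⟨Q₁, Q₂, rfl, h₁, h₀.append h₁', h₀.append h₂⟩

/-- Exchanging two neighbouring entries. -/
theorem exchange : ∀ {Γ₁ Γ₂ : Ctx W E} {a b : Entry W E} {Q : LCtx W}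
    {ρ : Env α ι (Γ₁ ++ b :: a :: Γ₂)}, EnvRel γ (Γ₁ ++ b :: a :: Γ₂) Q ρ →
    ∃ Q₁ Qb Qa Q₂ : LCtx W, Q = Q₁ ++ (Qb ++ (Qa ++ Q₂)) ∧ Q₁.wires = Γ₁.sharp ∧
      Qb.wires = b.ty.sharp ∧ Qa.wires = a.ty.sharp ∧ Q₂.wires = Γ₂.sharp ∧
      EnvRel γ (Γ₁ ++ a :: b :: Γ₂) (Q₁ ++ (Qa ++ (Qb ++ Q₂))) ρ.exchange
  | [], _, _, _, _, _, ⟨Qb, _, h, hb, Qa, Q₂, h', ha, h₂⟩ =>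
      ⟨[], Qb, Qa, Q₂, by rw [h, h']; rfl, rfl, hb.wires_eq, ha.wires_eq, h₂.wires_eq,
        ⟨Qa, Qb ++ Q₂, rfl, ha, Qb, Q₂, rfl, hb, h₂⟩⟩
  | c :: Γ₁, _, _, _, _, _, ⟨Qc, _, h, hc, h'⟩ => by
      obtain ⟨Q₁, Qb, Qa, Q₂, rfl, h₁, hb, ha, h₂, h'⟩ := h'.exchange
      refine ⟨Qc ++ Q₁, Qb, Qa, Q₂, by rw [h, List.append_assoc], ?_, hb, ha, h₂,
        ⟨Qc, _, by rw [List.append_assoc], hc, h'⟩⟩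
      rw [LCtx.wires_append, hc.wires_eq, h₁]; rfl

end EnvRel

end LogicalRelation

section Contexts

variable {E : Type u'} [Category.{v'} E] {W : Type w}

theorem Ctx.Distinct.var_not_mem {Γ Δ : Ctx W E} (h : Ctx.Distinct (Γ ++ Δ)) {x : ℕ} {A : Ty W E}
    (hx : Entry.var x A ∈ Δ) (B : Ty W E) : Entry.var x B ∉ Γ := by
  intro hB
  rw [Ctx.Distinct, List.map_append] at h
  exact (List.nodup_append'.1 h).2.2 (List.mem_map_of_mem (f := Entry.name) hB)
    (show (Entry.var x A).name ∈ Δ.map Entry.name from List.mem_map_of_mem hx)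

end Contexts

-- The fundamental property and adequacy at unit type.

section Fundamental

variable {M : Type u} [Category.{v} M] [StrictSymPremonoidal M]
  {E : Type u'} [Category.{v'} E] [CircuitAlgebra E] {α : Abstraction M E} {W : Type w} {ι : W → M}

mutual
/-- The fundamental property of the logical relation, for values. -/
theorem VTy.rel {γ : List (ℕ × Val ι E)} (hγ : ClosedSubst γ) : ∀ {Γ : Ctx W E} {V : Val ι E}
    {A : Ty W E} (d : VTy α Γ V A) {Q : LCtx W} {ρ : Env α ι Γ}, EnvRel γ Γ Q ρ →
    VRel A Q (V.substs γ) (d.sem ρ)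
  | _, _, _, .unit hΦ _, _, _, h => ⟨h.eq_nil hΦ, Val.Closed.substs_eq (V := .unit) (fun _ h => h) γ⟩
  | _, _, _, .nat n hΦ _, _, _, h =>
      ⟨h.eq_nil hΦ, Val.Closed.substs_eq (V := .nat n) (fun _ h => h) γ⟩
  | _, _, _, .lab l a hΦ _, _, _, h => by
      obtain ⟨Q₁, Q₂, rfl, h₁, h₂⟩ := h.split
      obtain rfl := h₁.eq_nil hΦ
      exact ⟨l, h₂.of_one, Val.Closed.substs_eq (V := .lab l) (fun _ h => h) γ⟩
  | _, _, _, .var x A hΦ _, _, _, h => by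
      obtain ⟨Q₁, Q₂, rfl, h₁, h₂⟩ := h.split
      obtain rfl := h₁.eq_nil hΦ
      exact h₂.of_one
  | _, _, _, .abs (x := x) (N := N) d, _, _, h => by
      refine ⟨h.wires_eq, Val.closed_substs hγ fun y hy => ?_, fun Q' V' a ha => ?_⟩
      · obtain ⟨B, hB⟩ := (VTy.abs d).free_mem hy
        exact h.closed_var hB
      · have hx := fun B => d.ctx_distinct.var_not_mem (List.mem_singleton.2 rfl) B
        have hd := d.computes ((hγ.without x).snoc x ha.closed) (h.snoc hγ ha hx)
        rw [Tm.substs_snoc] at hd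
        rw [Val.substs_abs]
        -- A β-step leaves the circuit untouched, so computability of the body transfers to the
        -- application.
        exact (hd.of_eval .app).cast _ _
  | _, _, _, .lift (N := N) hΦ d, _, _, h => by
      obtain rfl := h.eq_nil hΦ
      refine ⟨rfl, Val.closed_substs hγ fun y hy => ?_, ?_⟩
      · obtain ⟨B, hB⟩ := (VTy.lift hΦ d).free_mem hy
        exact h.closed_var hB
      · rw [Val.substs_lift]
        exact ((d.computes hγ h).of_eval .force).cast _ _
  | _, _, _, .circ C hΦ _ hQ hL σ τ hl hk, _, _, h =>
      ⟨h.eq_nil hΦ, _, _, _, _, _, _, C, σ, τ, hl, hk, hQ, hL,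
        Val.Closed.substs_eq (V := .boxed ..) (fun _ h => h) γ, rfl⟩
  | _, _, _, .pair hΦ _ d d', _, _, h => by
      obtain ⟨Q₁, Q₂, rfl, -, h₁, h₂⟩ := h.split_param hΦ
      exact ⟨Q₁, Q₂, _, _, rfl, Val.substs_pair _ _ _, d.rel hγ h₁, d'.rel hγ h₂⟩
/-- The fundamental property of the logical relation, for terms. -/
theorem CTy.computes {γ : List (ℕ × Val ι E)} (hγ : ClosedSubst γ) : ∀ {Γ : Ctx W E} {N : Tm ι E}
    {A : Ty W E} {e : Eff E} (d : CTy α Γ N A e) {Q : LCtx W} {ρ : Env α ι Γ}, EnvRel γ Γ Q ρ →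
    Computes (VRel A) Q (N.substs γ) (d.sem ρ).1 (d.sem ρ).2.1
  | _, _, _, _, .app hΦ _ d d', _, _, h => by
      obtain ⟨Q₁, Q₂, rfl, -, h₁, h₂⟩ := h.split_param hΦ
      rw [Tm.substs_app]
      exact ((d.rel hγ h₁).2.2 _ _ _ (d'.rel hγ h₂)).cast _ _
  | _, _, _, _, .force hΦ d, _, _, h => by
      obtain rfl := h.eq_nil hΦ
      rw [Tm.substs_force]
      exact (d.rel hγ h).2.2.cast _ _
  | _, _, _, _, .box hΦ d, _, _, h => by
      rw [Tm.substs_box]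
      exact (Computes.box (d.rel hγ h)).cast _ _
  | _, _, _, _, .apply hΦ _ d d', _, _, h => by
      obtain ⟨Q₁, Q₂, rfl, -, h₁, h₂⟩ := h.split_param hΦ
      rw [Tm.substs_apply]
      exact (Computes.apply (d.rel hγ h₁) (d'.rel hγ h₂) _).cast _ _
  | _, _, _, _, .dest (x := x) (y := y) hΦ _ d d', _, _, h => by
      obtain ⟨Q₂, Q₁, rfl, h₂, -, h₁⟩ := h.split_param hΦ
      obtain ⟨Qx, Qy, X, Y, rfl, hV, hX, hY⟩ := d.rel hγ h₁
      have hd := d'.ctx_distinct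
      have hx := fun B => hd.var_not_mem List.mem_cons_self B
      have hy := fun B => hd.var_not_mem (List.mem_cons_of_mem _ List.mem_cons_self) B
      have hxy : x ≠ y := by
        rw [Ctx.Distinct, List.map_append] at hd
        have := hd.of_append_right
        simpa [Entry.name] using this
      have hN := d'.computes ((((hγ.without x).without y).snoc x hX.closed).snoc y hY.closed)
        (h₂.snoc_snoc hγ hX hY hx hy hxy)
      rw [Tm.substs_snoc, Tm.substs_snoc] at hN
      rw [Tm.substs_dest, hV]
      exact (hN.of_eval .dest).cast _ _
  | _, _, _, _, .ifz hΦ d d₀ d₁, _, ρ, h => by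
      obtain ⟨Q₁, Q₂, -, h₁, -⟩ := h.split
      obtain ⟨-, hV⟩ := d.rel hγ h₁
      rw [Tm.substs_ifz, hV, CTy.sem]
      -- The relation at `Nat` makes the numeral in the term the one that selects the branch of the
      -- interpretation, so one case distinction settles both.
      generalize (d.sem ρ.left).down = n
      cases n with
      | zero => exact (d₀.computes hγ h).of_eval .ifz_zero
      | succ n => exact (d₁.computes hγ h).of_eval .ifz_succ
  | _, _, _, _, .ret d, _, _, h => by
      have hV := d.rel hγ h
      rw [Tm.substs_ret]
      exact (Computes.ret hV.wires_eq hV).cast _ _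
  | _, _, _, _, .letin (Γ₁ := Γ₁) (Γ₂ := Γ₂) (x := x) hΦ _ d d', _, _, h => by
      obtain ⟨Q₂, Q₁, rfl, h₂, -, h₁⟩ := h.split_param hΦ
      have hQ₂ : Q₂.wires = Γ₂.sharp := by
        rw [h₂.wires_eq, Ctx.sharp_append, hΦ.sharp_eq, List.nil_append]
      have hx := fun B => d'.ctx_distinct.var_not_mem (List.mem_singleton.2 rfl) B
      rw [Tm.substs_letin]
      refine (Computes.letin hQ₂ ((d.computes hγ h₁).cast _ _) fun Q' X hX => ?_).cast _ _
      have hN := d'.computes ((hγ.without x).snoc x hX.closed) (h₂.snoc hγ hX hx)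
      rw [Tm.substs_snoc] at hN
      exact hN.cast _ _
  -- `Computes` sees the circuit and not its bound, and subsumption changes only the bound.
  | _, _, _, _, .sub d _, _, _, h => d.computes hγ h
  | _, _, _, _, .ex (Γ₁ := Γ₁) (Γ₂ := Γ₂) (a := a) (b := b) d, _, _, h => by
      obtain ⟨Q₁, Qb, Qa, Q₂, rfl, h₁, hb, ha, h₂, h'⟩ := h.exchange
      obtain ⟨π, hπ⟩ := exists_lperm_exchange (ι := ι) Q₁ Qb Qa Q₂
      -- The labels of the two exchanged entries form blocks, and exchanging these blocks denotes
      -- the circuit with which the rule precomposes.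
      refine (((d.computes hγ h').cast _ _).precomp π ?_ ?_).cast _ _
      · simp only [LCtx.wires_append, h₁, hb, ha, h₂]
      · rw [h₁, hb, ha, h₂] at hπ
        exact hπ
end

/-- A closed configuration of unit type evaluates to `*`, and it appends a circuit bounded by its
effect. -/
theorem ConfigTy.adequate {C : LCirc ι []} {N : Tm ι E} {e : Eff E}
    (h : ConfigTy α C N .unit [] e) : ∃ F : Circ ι C.cod.wires [],
      Eff.Le (α.eff F) e ∧ (h.sem PUnit.unit).2 ≍ (C.hom ≫ F : Circ ι [] []) ∧
        Eval C N ⟨[], C.hom ≫ F⟩ .unit := by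
  obtain ⟨L, hL, hLd, d⟩ := h
  obtain ⟨Lc, f⟩ := C
  obtain rfl : Lc = L ++ [] := hL
  have hγ : ClosedSubst ([] : List (ℕ × Val ι E)) := fun _ h => (List.not_mem_nil h).elim
  obtain ⟨hS, H⟩ := d.computes hγ (EnvRel.ofLabels L)
  -- All outputs of `C` are consumed by the term: the frame is empty and no reordering is needed.
  obtain ⟨⟨Ld, g⟩, V, Q', hS', π', hE, -, hV, e'⟩ := H ⟨L ++ [], f⟩ [] (.refl _) hLd
  obtain ⟨rfl, rfl⟩ : Q' = [] ∧ V = .unit := hV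
  -- The value `*` uses no labels and the frame is empty, so the final circuit has no outputs and
  -- its permutation is an identity.
  obtain rfl : Ld = [] := List.perm_nil.1 π'.perm
  obtain ⟨_, hπ⟩ := π'.circ_of_eq_nil (ι := ι) rfl
  have hLS : LCtx.wires (L ++ []) = (L.toCtx : Ctx W E).sharp := by rw [List.append_nil, hS]
  have hw : ∀ {S : List W} (F : Circ ι S []), whiskR ι F [] ≍ F := fun F =>
    (whiskR_heq_wr F []).trans (wr_unit F)
  let F : Circ ι (L.toCtx : Ctx W E).sharp [] := (d.sem (Env.ofLabels L)).2.1
  have hF : Eff.Le (α.eff F) e := (d.sem (Env.ofLabels L)).2.2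
  have hg : g = f ≫ idc ι hLS ≫ F := by
    have h₁ : g ≫ idc ι (rfl : [] = []) =
        f ≫ (LPerm.refl (L ++ [])).circ ι ≫ idc ι (LCtx.wires_append_of_eq hS []) ≫
        whiskR ι F [] ≫ idc ι (rfl : [] = []) := by
      rw [hπ] at e'
      exact e'
    refine (Category.comp_id g).symm.trans (h₁.trans (eq_of_heq ?_))
    rw [LPerm.circ_refl, Category.id_comp]
    refine comp_heq_comp rfl rfl rfl HEq.rfl ((conj_idc_heq _ _ _).trans ((hw F).trans ?_))
    exact (eqToHom_comp_heq_self _ _).symm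
  refine ⟨idc ι hLS ≫ F, ?_, ?_, hg ▸ hE⟩
  · rw [idc, Abstraction.eff_eqToHom_comp]
    exact hF
  · refine comp_heq_comp rfl rfl rfl HEq.rfl ((eqToHom_comp_heq_self _ _).trans ((hw _).trans ?_))
    exact (eqToHom_comp_heq_self _ _).trans (eqToHom_comp_heq_self _ _).symm

/-- The fundamental property with the empty substitution rules out variables and leftover labels: a
value of unit type typed under labels alone is `*`, and there are no labels. All the transports in
its denotation are then identities. -/
theorem ValConfigTy.of_unit {D : LCirc ι []} {V : Val ι E} (h : ValConfigTy α D V .unit []) :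
    D.cod = [] ∧ V = .unit ∧ h.sem.2 ≍ D.hom := by
  obtain ⟨L, hL, -, d⟩ := h
  obtain ⟨Ld, g⟩ := D
  have hγ : ClosedSubst ([] : List (ℕ × Val ι E)) := fun _ h => (List.not_mem_nil h).elim
  obtain ⟨rfl, rfl⟩ : L = [] ∧ V = .unit := d.rel hγ (EnvRel.ofLabels L)
  obtain rfl : Ld = [] := hL
  refine ⟨rfl, rfl, ?_⟩
  have hw : g ≫ idc ι rfl ≫ whiskR ι (idc ι rfl : Circ ι [] []) [] = g := by
    rw [whiskR_idc]
    exact (congrArg (g ≫ ·) (Category.id_comp _)).trans (Category.comp_id g)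
  exact heq_of_eq hw

end Fundamental
end ProtoQuipper

open ProtoQuipper
theorem mainTheorem4
    {M : Type u} [Category.{v} M] [StrictSymPremonoidal M]
    {E : Type u'} [Category.{v'} E] [CircuitAlgebra E]
    (α : Abstraction M E) {W : Type w} (ι : W → M)
    (C : LCirc ι []) (N : Tm ι E)
    (t : E) (e : t ⟶ StrictSymPremonoidal.unit)
    (hN : ConfigTy α C N .unit [] ⟨t, StrictSymPremonoidal.unit, e⟩)
    (D : LCirc ι []) (V : Val ι E)
    (hV : ValConfigTy α D V .unit [])
    (h : hN.sem = fun x => CircMonad.forget (J α hV.sem x)) :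
    Eval C N D V ∧
      ∃ F : Circ ι C.cod.wires D.cod.wires,
        Eff.Le (α.eff F) ⟨t, StrictSymPremonoidal.unit, e⟩ ∧ C.hom ≫ F = D.hom := by
  obtain ⟨F, hF, hs, hE⟩ := hN.adequate
  obtain ⟨hD, rfl, hs'⟩ := hV.of_unit
  -- Only the circuit components of the two denotations are compared; at unit type the value
  -- components carry no information.
  have hg : (C.hom ≫ F : Circ ι [] []) ≍ D.hom :=
    hs.symm.trans ((heq_of_eq (congrArg Prod.snd (congrFun h PUnit.unit))).trans hs')
  obtain ⟨Ld, g⟩ := D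
  obtain rfl : Ld = [] := hD
  obtain rfl := eq_of_heq hg
  exact ⟨hE, F, hF, rfl⟩
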